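/- Let $n\in\mathbb N$, $r,Q>0$, $p>2n$ and $\beta\in(\tfrac12,\,1-\tfrac np)$. Write $B(x,s)$ for the open Euclidean ball in $\mathbb R^n$ and $B_\infty(x,s)=x+(-s,s)^n$ for the open ball of the maximum norm. A mollification kernel is a smooth function $\varphi:\mathbb R^n\to[0,1]$, supported on $[-1,1]^n$, with $\varphi(0)=\int\varphi=1$; put $\varphi_t(x)=t^{-n}\varphi(x/t)$ and $P_tf=\varphi_t*f$ (componentwise for tensors; a function on $B(0,r)$ is extended by zero). For a smooth Riemannian manifold $(M,g)$ of dimension $n$ with base point $x_0$ and a chart $\psi:(B(0,r),0)\to(M,x_0)$ of the smooth atlas (written as a parametrization), let $g_{\cdot\cdot}=\psi^*g$ be the coordinate metric on $B(0,r)$. We write $\|\psi\|_{W^{2,p},r}\le Q$ if $$e^{-2Q}|v|^2\le g_{kl}(x)v^kv^l\le e^{2Q}|v|^2\quad(x\in B(0,r),\ v\in\mathbb R^n)\qquad\text{and}\qquad r^{k-n/p}\,\|\nabla^k g_{\cdot\cdot}\|_{L^p(B(0,r))}\le Q\quad(k=0,1,2),$$ where $|v|$ is the Euclidean norm of $v$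 and $\nabla^kg_{\cdot\cdot}$ is the vector of all $k$-th partial derivatives of the components, measured pointwise in the maximum norm. For a metric $h$ in coordinates with curvature components $R^\rho{}_{\sigma\mu\nu}$ and $w=(w_1,w_2,w_3,w_4)$ consisting of three vectors and one covector of $\mathbb R^n$, let $\mathrm{Riem}_h(y)(w)=R^\rho{}_{\sigma\mu\nu}(y)\,w_1^\mu w_2^\nu w_3^\sigma w_{4,\rho}$. Then there are $T\in(0,\tfrac r2)$ and $C>0$, depending only on $n,p,r,Q,\beta$, such that for every mollification kernel $\varphi$, every pointed smooth Riemannian manifold $(M,g,x_0)$ of dimension $n$, every chart $\psi$ as above with $\|\psi\|_{W^{2,p},r}\le Q$ and every $t\in(0,T]$, the tensor $P_t(g_{\cdot\cdot})$ is a smooth Riemannian metric on $B(0,\tfrac r2)$, and for every bounded smooth section $v$ of $T^{3,1}B(0,r)$, regarded as a map $v:B(0,r)\to\mathbb R^{4n}$ with the maximum norm on $\mathbb R^{4n}$, and every $x\in B(0,\tfrac r2)$, $$\mathrm{Riem}_{P_t(g_{\cdot\cdot})}(x)(v(x))-\sup_{y\in B_\infty(x,t)}\mathrm{Riem}_{g_{\cdot\cdot}}(y)(v(x))\le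 C\,\|v\|_{L^\infty}^4\,t^\beta,$$ where the supremum is finite and $v(x)$ is moved to the point $y$ by the canonical identification $T_x\mathbb R^n=T_y\mathbb R^n$. If $\varphi$ is moreover supported in the closed Euclidean unit ball, the same holds with the Euclidean ball $B(x,t)$ in place of $B_\infty(x,t)$. -/

import Mathlib

open Set Filter Topology MeasureTheory Metric
open scoped ENNReal Manifold ContDiff

noncomputable section

namespace MollifiedCurvature

/-- `ℝⁿ` with the Euclidean norm; its balls are Euclidean balls. -/
abbrev Eucl (n : ℕ) : Type := EuclideanSpace ℝ (Fin n)

/-- The `i`-th standard basis vector of `ℝⁿ`. -/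
def stdVec {n : ℕ} (i : Fin n) : Eucl n := EuclideanSpace.single i (1 : ℝ)

/-- The open ball of radius `t` around `x` for the maximum norm, i.e. `x + (-t, t)ⁿ`. -/
def openCube {n : ℕ} (x : Eucl n) (t : ℝ) : Set (Eucl n) := {y | ∀ i, |y i - x i| < t}

/-! ### Tensors in coordinates

A (0,2)-tensor field on a subset of `ℝⁿ` is given by its matrix of components. -/

/-- The partial derivative `∂ᵢ f (x)`. -/
def partialDeriv {n : ℕ} (i : Fin n) (f : Eucl n → ℝ) (x : Eucl n) : ℝ :=
  fderiv ℝ f x (stdVec i)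

/-- `Γⁱₖₗ = ½ gⁱᵐ (∂ₗ gₘₖ + ∂ₖ gₘₗ - ∂ₘ gₖₗ)`. -/
def christoffel {n : ℕ} (G : Eucl n → Matrix (Fin n) (Fin n) ℝ) (i k l : Fin n)
    (x : Eucl n) : ℝ :=
  (1 / 2 : ℝ) * ∑ m, (G x)⁻¹ i m *
    (partialDeriv l (fun y => G y m k) x + partialDeriv k (fun y => G y m l) x
      - partialDeriv m (fun y => G y k l) x)

/-- The components `R^ρ_{σμν}` of the Riemannian curvature tensor of `G`:
`∂_μ Γ^ρ_{νσ} - ∂_ν Γ^ρ_{μσ} + Γ^ρ_{μκ} Γ^κ_{νσ} - Γ^ρ_{νκ} Γ^κ_{μσ}`. -/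
def riemComp {n : ℕ} (G : Eucl n → Matrix (Fin n) (Fin n) ℝ) (ρ σ μ ν : Fin n)
    (x : Eucl n) : ℝ :=
  partialDeriv μ (christoffel G ρ ν σ) x - partialDeriv ν (christoffel G ρ μ σ) x
    + ∑ κ, (christoffel G ρ μ κ x * christoffel G κ ν σ x
      - christoffel G ρ ν κ x * christoffel G κ μ σ x)

/-- `Riem_G(x)(w) = w₃ (R(w₀, w₁) w₂)` for tangent vectors `w₀, w₁, w₂` and a covector `w₃`, all
given by their components in `ℝⁿ`. -/
def riem {n : ℕ} (G : Eucl n → Matrix (Fin n) (Fin n) ℝ) (x : Eucl n)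
    (w : Fin 4 → Fin n → ℝ) : ℝ :=
  ∑ ρ, ∑ σ, ∑ μ, ∑ ν, riemComp G ρ σ μ ν x * w 0 μ * w 1 ν * w 2 σ * w 3 ρ

/-- All partial derivatives of order `k` of all components of `G`. The norm of this function space
over finite index sets is the maximum norm. -/
def nablaPow {n : ℕ} (k : ℕ) (G : Eucl n → Matrix (Fin n) (Fin n) ℝ) (x : Eucl n) :
    Fin n → Fin n → (Fin k → Fin n) → ℝ :=
  fun a b I => iteratedFDeriv ℝ k (fun y => G y a b) x (fun m => stdVec (I m))

/-! ### Mollification -/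

/-- A mollification kernel: a smooth function `φ : ℝⁿ → [0,1]` supported on `[-1,1]ⁿ` with
`φ(0) = ∫ φ = 1`. -/
structure IsMollificationKernel {n : ℕ} (φ : Eucl n → ℝ) : Prop where
  contDiff : ContDiff ℝ ∞ φ
  nonneg : ∀ x, 0 ≤ φ x
  le_one : ∀ x, φ x ≤ 1
  support_subset : Function.support φ ⊆ {x | ∀ i, |x i| ≤ 1}
  map_zero : φ 0 = 1
  integral_eq_one : ∫ x, φ x = 1

/-- `φ_t(x) = t⁻ⁿ φ(x/t)`. -/
def scaledKernel {n : ℕ} (φ : Eucl n → ℝ) (t : ℝ) (x : Eucl n) : ℝ :=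
  (t ^ n)⁻¹ * φ (t⁻¹ • x)

/-- `P_t f = φ_t * f`. -/
def mollify {n : ℕ} (φ : Eucl n → ℝ) (t : ℝ) (f : Eucl n → ℝ) : Eucl n → ℝ :=
  convolution (scaledKernel φ t) f (ContinuousLinearMap.lsmul ℝ ℝ) volume

/-- The componentwise mollification `P_t G` of a tensor field `G` on `B(0,r)`, which is extended
by zero outside of the ball. -/
def mollifyMetric {n : ℕ} (φ : Eucl n → ℝ) (r t : ℝ) (G : Eucl n → Matrix (Fin n) (Fin n) ℝ)
    (x : Eucl n) : Matrix (Fin n) (Fin n) ℝ :=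
  Matrix.of fun a b => mollify φ t ((ball (0 : Eucl n) r).indicator fun y => G y a b) x

/-! ### Charts and chart norms -/

section Manifold

variable {n : ℕ} {M : Type*} [TopologicalSpace M] [ChartedSpace (Eucl n) M]
  [IsManifold 𝓘(ℝ, Eucl n) ∞ M]

/-- Smooth Riemannian metrics on the `n`-dimensional smooth manifold `M`. -/
abbrev SmoothMetric (n : ℕ) (M : Type*) [TopologicalSpace M] [ChartedSpace (Eucl n) M]
    [IsManifold 𝓘(ℝ, Eucl n) ∞ M] : Type _ :=
  Bundle.ContMDiffRiemannianMetric (IB := 𝓘(ℝ, Eucl n)) (n := ∞) (F := Eucl n)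
    (E := fun x : M => TangentSpace 𝓘(ℝ, Eucl n) x)

/-- The components of `ψ^* g`: `g(ψ x)(∂ᵢψ(x), ∂ⱼψ(x))`. -/
def pullbackMetric (g : SmoothMetric n M) (ψ : Eucl n → M) (x : Eucl n) :
    Matrix (Fin n) (Fin n) ℝ :=
  Matrix.of fun i j =>
    g.inner (ψ x) (mfderiv 𝓘(ℝ, Eucl n) 𝓘(ℝ, Eucl n) ψ x (stdVec i))
      (mfderiv 𝓘(ℝ, Eucl n) 𝓘(ℝ, Eucl n) ψ x (stdVec j))

/-- `ψ : (B(0,r), 0) → (M, x₀)` is a pointed chart compatible with the smooth atlas of `M`; the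
chart is written as a parametrization, so it is its inverse that belongs to the atlas. -/
structure IsPointedChart (r : ℝ) (x₀ : M) (ψ : OpenPartialHomeomorph (Eucl n) M) : Prop where
  source_eq : ψ.source = ball (0 : Eucl n) r
  map_zero : ψ 0 = x₀
  mem_atlas : ψ.symm ∈ IsManifold.maximalAtlas 𝓘(ℝ, Eucl n) ∞ M

end Manifold

/-- For the coordinate metric `G` on `B(0,r)` of a chart `ψ`, this says `‖ψ‖_{W^{m,p},r} ≤ Q`: the
chart norm is the least `Q ≥ 0` with `e^{-2Q}|v|² ≤ G(x)(v,v) ≤ e^{2Q}|v|²` on `B(0,r)` and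
`r^{k-n/p} ‖∇ᵏ G‖_{Lᵖ(B(0,r))} ≤ Q` for `k = 0, …, m`. All conditions persist when `Q` grows. -/
structure SobolevChartNormLE {n : ℕ} (m : ℕ) (p r Q : ℝ)
    (G : Eucl n → Matrix (Fin n) (Fin n) ℝ) : Prop where
  lower : ∀ x ∈ ball (0 : Eucl n) r, ∀ v : Eucl n,
    Real.exp (-2 * Q) * ‖v‖ ^ 2 ≤ ∑ k, ∑ l, G x k l * v k * v l
  upper : ∀ x ∈ ball (0 : Eucl n) r, ∀ v : Eucl n,
    ∑ k, ∑ l, G x k l * v k * v l ≤ Real.exp (2 * Q) * ‖v‖ ^ 2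
  sobolev : ∀ k : ℕ, k ≤ m →
    ENNReal.ofReal (r ^ ((k : ℝ) - n / p)) *
      eLpNorm (nablaPow k G) (ENNReal.ofReal p) (volume.restrict (ball (0 : Eucl n) r))
        ≤ ENNReal.ofReal Q

/-- `Riem_{G'}(x)(w) - sup_{y ∈ S} Riem_G(y)(w) ≤ b`, where the supremum is finite. -/
def CurvatureExcessLE {n : ℕ} (G' G : Eucl n → Matrix (Fin n) (Fin n) ℝ) (x : Eucl n)
    (S : Set (Eucl n)) (w : Fin 4 → Fin n → ℝ) (b : ℝ) : Prop :=
  BddAbove ((fun y => riem G y w) '' S) ∧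
    riem G' x w - sSup ((fun y => riem G y w) '' S) ≤ b

end MollifiedCurvature

end

/-!
In coordinates, `Riem = A(g⁻¹, ∂²g) + B(g⁻¹, ∂g)` with `A` bilinear and `B` polynomial.
Mollification commutes with derivatives, so the curvature of `P_t g` differs from `P_t Riem` only by
two commutators. Since `p > n`, Morrey's inequality bounds `∂g` and makes it oscillate by
`O(t ^ (1 - n / p))` at scale `t`, hence `g⁻¹` oscillates by `O(t)`. The second derivatives are
merely in `Lᵖ`: by Hölder's inequality `P_t |∂²g| = O(t ^ (-(n / p)))`. Both commutators are
therefore `O(t ^ (1 - n / p))`, while `P_t (Riem(·)(w))`, being an average of the values near `x`,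
is at most their supremum.
-/

namespace MollifiedCurvature

section CompactlySupportedMeasure

variable {Y V : Type*} [TopologicalSpace Y] [T2Space Y] [MeasurableSpace Y]
  [OpensMeasurableSpace Y] [NormedAddCommGroup V] {μ : Measure Y} [IsFiniteMeasure μ] {k : Set Y}

lemma integrable_of_continuousOn_of_ae_mem (hk : IsCompact k) (hμ : ∀ᵐ y ∂μ, y ∈ k) {f : Y → V}
    (hf : ContinuousOn f k) : Integrable f μ := by
  rw [← Measure.restrict_eq_self_of_ae_mem hμ]
  exact hf.integrableOn_compact hk

lemma hasFDerivAt_integral_of_ae_mem {H : Type*} [NormedAddCommGroup H] [NormedSpace ℝ H]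
    [ProperSpace H] [NormedSpace ℝ V] (hk : IsCompact k) (hμ : ∀ᵐ y ∂μ, y ∈ k) {f : H → Y → V}
    {f' : H → Y → H →L[ℝ] V} (hf : ∀ x, Continuous (f x)) (hf' : Continuous ↿f')
    (hd : ∀ x y, HasFDerivAt (f · y) (f' x y) x) (x₀ : H) :
    HasFDerivAt (fun x => ∫ y, f x y ∂μ) (∫ y, f' x₀ y ∂μ) x₀ := by
  obtain ⟨C, hC⟩ := ((isCompact_closedBall x₀ 1).prod hk).exists_bound_of_continuousOn
    hf'.continuousOn
  have hint (x : H) := integrable_of_continuousOn_of_ae_mem hk hμ (hf x).continuousOn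
  have hint' := integrable_of_continuousOn_of_ae_mem hk hμ
    (hf'.uncurry_left x₀ : Continuous (f' x₀)).continuousOn
  refine hasFDerivAt_integral_of_dominated_of_fderiv_le (bound := fun _ => C)
    (closedBall_mem_nhds x₀ one_pos) (.of_forall fun x => (hint x).aestronglyMeasurable)
    (hint x₀) hint'.aestronglyMeasurable ?_ (integrable_const C) (.of_forall fun y x _ => hd x y)
  filter_upwards [hμ] with y hy x hx using hC (x, y) ⟨hx, hy⟩

end CompactlySupportedMeasure

lemma nonneg_of_ae_norm_le {E : Type*} [SeminormedAddGroup E] [MeasurableSpace E] {μ : Measure E}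
    [NeZero μ] {R : ℝ} (hμ : ∀ᵐ z ∂μ, ‖z‖ ≤ R) : 0 ≤ R :=
  let ⟨z, hz⟩ := hμ.exists
  (norm_nonneg z).trans hz

section Average

variable {E V W : Type*} [NormedAddCommGroup E] [NormedSpace ℝ E]
  [NormedAddCommGroup V] [NormedSpace ℝ V] [NormedAddCommGroup W] [NormedSpace ℝ W]

lemma sub_smul_mem_closedBall {R t : ℝ} {z : E} (ht : 0 ≤ t) (hz : ‖z‖ ≤ R) (x : E) :
    x - t • z ∈ closedBall x (R * t) := by
  simpa [norm_smul, abs_of_nonneg ht, mul_comm R] using mul_le_mul_of_nonneg_left hz ht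

variable [MeasurableSpace E]

/-- The average of the translates `f (x - t • z)` with respect to `μ`. For the measure with density
`φ` it is the mollification `φ_t * f`. -/
noncomputable def avg (μ : Measure E) (t : ℝ) (f : E → V) (x : E) : V :=
  ∫ z, f (x - t • z) ∂μ

variable {μ : Measure E} {R t : ℝ} {x : E} {f : E → V}

lemma ae_sub_smul_mem_closedBall (hμ : ∀ᵐ z ∂μ, ‖z‖ ≤ R) (ht : 0 ≤ t) (x : E) :
    ∀ᵐ z ∂μ, x - t • z ∈ closedBall x (R * t) :=
  hμ.mono fun _ hz => sub_smul_mem_closedBall ht hz x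

lemma le_restrict_preimage_sub_smul {ν : Measure E} {U : Set E} (hμν : μ ≤ ν)
    (hμ : ∀ᵐ z ∂μ, ‖z‖ ≤ R) (ht : 0 ≤ t) (hU : closedBall x (R * t) ⊆ U) :
    μ ≤ ν.restrict ((fun z => x - t • z) ⁻¹' U) := by
  rw [← Measure.restrict_eq_self_of_ae_mem ((ae_sub_smul_mem_closedBall hμ ht x).mono
    fun z hz => mem_preimage.2 (hU hz))]
  exact Measure.restrict_mono subset_rfl hμν

lemma avg_congr (hμ : ∀ᵐ z ∂μ, ‖z‖ ≤ R) (ht : 0 ≤ t) {g : E → V}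
    (h : EqOn f g (closedBall x (R * t))) : avg μ t f x = avg μ t g x :=
  integral_congr_ae ((ae_sub_smul_mem_closedBall hμ ht x).mono fun _ hz => h hz)

variable [IsProbabilityMeasure μ]

lemma avg_zero_left [CompleteSpace V] (f : E → V) (x : E) : avg μ 0 f x = f x := by
  simp [avg]

lemma norm_avg_le (hμ : ∀ᵐ z ∂μ, ‖z‖ ≤ R) (ht : 0 ≤ t) {C : ℝ}
    (hf : ∀ y ∈ closedBall x (R * t), ‖f y‖ ≤ C) : ‖avg μ t f x‖ ≤ C := by
  simpa [avg] using norm_integral_le_of_norm_le_const (μ := μ)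
    ((ae_sub_smul_mem_closedBall hμ ht x).mono fun z hz => hf _ hz)

variable [FiniteDimensional ℝ E] [BorelSpace E]

lemma integrable_comp_sub_smul {V : Type*} [NormedAddCommGroup V] {f : E → V}
    (hμ : ∀ᵐ z ∂μ, ‖z‖ ≤ R) (ht : 0 ≤ t) (hf : ContinuousOn f (closedBall x (R * t))) :
    Integrable (fun z => f (x - t • z)) μ := by
  have := FiniteDimensional.proper ℝ E
  refine integrable_of_continuousOn_of_ae_mem (isCompact_closedBall (0 : E) R) (by simpa using hμ)
    (hf.comp (by fun_prop) fun z hz => ?_)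
  exact sub_smul_mem_closedBall ht (by simpa using hz) x

lemma norm_sub_avg_le [CompleteSpace V] (hμ : ∀ᵐ z ∂μ, ‖z‖ ≤ R) (ht : 0 ≤ t)
    (hf : ContinuousOn f (closedBall x (R * t))) {v : V} {C : ℝ}
    (hC : ∀ y ∈ closedBall x (R * t), ‖v - f y‖ ≤ C) : ‖v - avg μ t f x‖ ≤ C := by
  have h : v - avg μ t f x = avg μ t (fun y => v - f y) x := by
    simp [avg, integral_sub (integrable_const v) (integrable_comp_sub_smul hμ ht hf)]
  exact h ▸ norm_avg_le hμ ht hC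

lemma avg_add {g : E → V} (hμ : ∀ᵐ z ∂μ, ‖z‖ ≤ R) (ht : 0 ≤ t)
    (hf : ContinuousOn f (closedBall x (R * t))) (hg : ContinuousOn g (closedBall x (R * t))) :
    avg μ t (f + g) x = avg μ t f x + avg μ t g x :=
  integral_add (integrable_comp_sub_smul hμ ht hf) (integrable_comp_sub_smul hμ ht hg)

lemma avg_clm_comp [CompleteSpace V] [CompleteSpace W] (hμ : ∀ᵐ z ∂μ, ‖z‖ ≤ R) (ht : 0 ≤ t)
    (hf : ContinuousOn f (closedBall x (R * t))) (L : V →L[ℝ] W) :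
    avg μ t (fun y => L (f y)) x = L (avg μ t f x) :=
  L.integral_comp_comm (integrable_comp_sub_smul hμ ht hf)

lemma norm_bilin_avg_sub_avg_bilin_le {X : Type*} [NormedAddCommGroup X] [NormedSpace ℝ X]
    [CompleteSpace V] [CompleteSpace W] (hμ : ∀ᵐ z ∂μ, ‖z‖ ≤ R) (ht : 0 ≤ t)
    (B : X →L[ℝ] V →L[ℝ] W) {J : E → X} (hJ : ContinuousOn J (closedBall x (R * t)))
    (hf : ContinuousOn f (closedBall x (R * t))) {J₀ : X} {δ : ℝ}
    (hδ : ∀ y ∈ closedBall x (R * t), ‖J₀ - J y‖ ≤ δ) :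
    ‖B J₀ (avg μ t f x) - avg μ t (fun y => B (J y) (f y)) x‖ ≤
      ‖B‖ * δ * avg μ t (fun y => ‖f y‖) x := by
  have hint : Integrable (fun z => B J₀ (f (x - t • z))) μ :=
    integrable_comp_sub_smul (f := fun y => B J₀ (f y)) hμ ht (by fun_prop)
  have hint' : Integrable (fun z => B (J (x - t • z)) (f (x - t • z))) μ :=
    integrable_comp_sub_smul (f := fun y => B (J y) (f y)) hμ ht (by fun_prop)
  rw [← avg_clm_comp hμ ht hf, avg, avg, avg, ← integral_sub hint hint', ← integral_const_mul]
  refine norm_integral_le_of_norm_le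
    ((integrable_comp_sub_smul hμ ht hf).norm.const_mul _) ?_
  filter_upwards [ae_sub_smul_mem_closedBall hμ ht x] with z hz
  rw [← sub_apply, ← map_sub]
  exact (B.le_opNorm₂ _ _).trans (by gcongr; exact hδ _ hz)

lemma hasFDerivAt_avg (hμ : ∀ᵐ z ∂μ, ‖z‖ ≤ R) (hf : ContDiff ℝ 1 f) (t : ℝ) (x : E) :
    HasFDerivAt (avg μ t f) (avg μ t (fderiv ℝ f) x) x := by
  have := FiniteDimensional.proper ℝ E
  have hf' : Continuous (fderiv ℝ f) := hf.continuous_fderiv one_ne_zero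
  refine hasFDerivAt_integral_of_ae_mem (f := fun y z => f (y - t • z))
    (f' := fun y z => fderiv ℝ f (y - t • z)) (isCompact_closedBall (0 : E) R)
    (by simpa using hμ) (fun y => by fun_prop) (hf'.comp (by fun_prop)) (fun y z => ?_) x
  exact (hf.differentiable one_ne_zero _).hasFDerivAt.comp y ((hasFDerivAt_id y).sub_const (t • z))

lemma fderiv_avg (hμ : ∀ᵐ z ∂μ, ‖z‖ ≤ R) (hf : ContDiff ℝ 1 f) (t : ℝ) :
    fderiv ℝ (avg μ t f) = avg μ t (fderiv ℝ f) :=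
  funext fun x => (hasFDerivAt_avg hμ hf t x).fderiv

lemma differentiable_avg (hμ : ∀ᵐ z ∂μ, ‖z‖ ≤ R) (hf : ContDiff ℝ 1 f) (t : ℝ) :
    Differentiable ℝ (avg μ t f) :=
  fun x => (hasFDerivAt_avg hμ hf t x).differentiableAt

lemma exists_hasDerivAt_avg (hμ : ∀ᵐ z ∂μ, ‖z‖ ≤ R) (hf : ContDiff ℝ 1 f) (x : E) (τ : ℝ) :
    ∃ v, HasDerivAt (fun τ => avg μ τ f x) v τ ∧
      ‖v‖ ≤ R * avg μ τ (fun y => ‖fderiv ℝ f y‖) x := by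
  have := FiniteDimensional.proper ℝ E
  have hf' : Continuous (fderiv ℝ f) := hf.continuous_fderiv one_ne_zero
  set f' : ℝ → E → ℝ →L[ℝ] V :=
    fun τ z => ContinuousLinearMap.toSpanSingleton ℝ (fderiv ℝ f (x - τ • z) (-z))
  have hd : HasFDerivAt (fun τ => avg μ τ f x) (∫ z, f' τ z ∂μ) τ := by
    refine hasFDerivAt_integral_of_ae_mem (f := fun τ z => f (x - τ • z))
      (isCompact_closedBall (0 : E) R) (by simpa using hμ) (fun y => by fun_prop) ?_
      (fun τ z => ?_) τ
    · exact (ContinuousLinearMap.toSpanSingletonCLE (𝕜 := ℝ) (E := V)).continuous.comp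
        ((hf'.comp (by fun_prop)).clm_apply (by fun_prop))
    · have h : HasDerivAt (fun τ : ℝ => x - τ • z) (-z) τ := by
        simpa using ((hasDerivAt_id τ).smul_const z).const_sub x
      exact ((hf.differentiable one_ne_zero _).hasFDerivAt.comp_hasDerivAt τ h).hasFDerivAt
  refine ⟨_, hd.hasDerivAt, ?_⟩
  calc ‖(∫ z, f' τ z ∂μ) 1‖ ≤ ‖∫ z, f' τ z ∂μ‖ := by simpa using (∫ z, f' τ z ∂μ).le_opNorm 1
    _ ≤ ∫ z, R * ‖fderiv ℝ f (x - τ • z)‖ ∂μ := by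
      refine norm_integral_le_of_norm_le
        (Integrable.const_mul (integrable_of_continuousOn_of_ae_mem (isCompact_closedBall (0 : E) R)
          (by simpa using hμ) (by fun_prop)) R) ?_
      filter_upwards [hμ] with z hz
      calc ‖f' τ z‖ ≤ ‖fderiv ℝ f (x - τ • z)‖ * ‖-z‖ := by
            simpa [f'] using (fderiv ℝ f (x - τ • z)).le_opNorm (-z)
        _ ≤ R * ‖fderiv ℝ f (x - τ • z)‖ := by rw [norm_neg, mul_comm]; gcongr
    _ = R * avg μ τ (fun y => ‖fderiv ℝ f y‖) x := integral_const_mul ..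

end Average

section Morrey

open Module (finrank)

variable {E V : Type*} [NormedAddCommGroup E] [NormedSpace ℝ E] [MeasurableSpace E] [BorelSpace E]
  [FiniteDimensional ℝ E] [NormedAddCommGroup V] {μ ν : Measure E} [ν.IsAddHaarMeasure]
  {R p t K K₀ T : ℝ} {U : Set E} {x : E} {f : E → V}

lemma map_sub_smul_addHaar (ν : Measure E) [ν.IsAddHaarMeasure] (ht : 0 < t) (x : E) :
    ν.map (fun z => x - t • z) = ENNReal.ofReal ((t ^ finrank ℝ E)⁻¹) • ν := by
  rw [show (fun z => x - t • z) = (fun y => x - y) ∘ (t • ·) from rfl,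
    ← Measure.map_map (by fun_prop) (by fun_prop), Measure.map_addHaar_smul _ ht.ne',
    Measure.map_smul, (Measure.measurePreserving_sub_left ν x).map_eq, abs_of_pos (by positivity)]

lemma eLpNorm_comp_sub_smul_le (hμν : μ ≤ ν) (hμ : ∀ᵐ z ∂μ, ‖z‖ ≤ R) (hp : 0 < p) (ht : 0 < t)
    (hUm : MeasurableSet U) (hU : closedBall x (R * t) ⊆ U) (hf : Continuous f) :
    eLpNorm (fun z => f (x - t • z)) (ENNReal.ofReal p) μ ≤
      ENNReal.ofReal (t ^ (-(finrank ℝ E / p : ℝ))) *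
        eLpNorm f (ENNReal.ofReal p) (ν.restrict U) := by
  have hT : Continuous fun z : E => x - t • z := by fun_prop
  have hscale : ENNReal.ofReal ((t ^ finrank ℝ E)⁻¹) ^ (1 / ENNReal.ofReal p).toReal =
      ENNReal.ofReal (t ^ (-(finrank ℝ E / p : ℝ))) := by
    rw [ENNReal.toReal_div, ENNReal.toReal_one, ENNReal.toReal_ofReal hp.le,
      ENNReal.ofReal_rpow_of_pos (by positivity), ← Real.rpow_natCast, ← Real.rpow_neg ht.le,
      ← Real.rpow_mul ht.le]
    congr 2
    ring
  calc eLpNorm (f ∘ fun z => x - t • z) (ENNReal.ofReal p) μ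
      ≤ eLpNorm (f ∘ fun z => x - t • z) (ENNReal.ofReal p)
          (ν.restrict ((fun z => x - t • z) ⁻¹' U)) :=
        eLpNorm_mono_measure _ (le_restrict_preimage_sub_smul hμν hμ ht.le hU)
    _ = _ := by
        rw [← eLpNorm_map_measure hf.aestronglyMeasurable hT.aemeasurable,
          ← Measure.restrict_map hT.measurable hUm, map_sub_smul_addHaar ν ht,
          Measure.restrict_smul, eLpNorm_smul_measure_of_ne_top ENNReal.ofReal_ne_top, hscale,
          smul_eq_mul]

variable [IsProbabilityMeasure μ]

lemma avg_norm_le_of_eLpNorm_le (hK0 : 0 ≤ K) (hμν : μ ≤ ν) (hμ : ∀ᵐ z ∂μ, ‖z‖ ≤ R)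
    (hp : 1 ≤ p) (ht : 0 < t) (hUm : MeasurableSet U) (hU : closedBall x (R * t) ⊆ U)
    (hf : Continuous f)
    (hK : eLpNorm f (ENNReal.ofReal p) (ν.restrict U) ≤ ENNReal.ofReal K) :
    avg μ t (fun y => ‖f y‖) x ≤ t ^ (-(finrank ℝ E / p : ℝ)) * K := by
  have hc : Continuous fun z => f (x - t • z) := by fun_prop
  calc avg μ t (fun y => ‖f y‖) x = (eLpNorm (fun z => f (x - t • z)) 1 μ).toReal := by
        rw [eLpNorm_one_eq_lintegral_enorm, ← integral_norm_eq_lintegral_enorm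
          hc.aestronglyMeasurable, avg]
    _ ≤ t ^ (-(finrank ℝ E / p : ℝ)) * K := by
      refine ENNReal.toReal_le_of_le_ofReal (by positivity) ?_
      rw [ENNReal.ofReal_mul (by positivity)]
      calc eLpNorm (fun z => f (x - t • z)) 1 μ
          ≤ eLpNorm (fun z => f (x - t • z)) (ENNReal.ofReal p) μ :=
            eLpNorm_le_eLpNorm_of_exponent_le (by simpa using hp) hc.aestronglyMeasurable
        _ ≤ _ := (eLpNorm_comp_sub_smul_le hμν hμ (by positivity) ht hUm hU hf).trans (by gcongr)

variable [NormedSpace ℝ V] [CompleteSpace V]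

lemma norm_avg_sub_le_of_eLpNorm_fderiv_le (hK0 : 0 ≤ K) (hμν : μ ≤ ν) (hμ : ∀ᵐ z ∂μ, ‖z‖ ≤ R)
    (hp : 1 ≤ p) (hdp : finrank ℝ E < p) (ht : 0 < t) (hUm : MeasurableSet U)
    (hU : closedBall x (R * t) ⊆ U) (hf : ContDiff ℝ 1 f)
    (hK : eLpNorm (fderiv ℝ f) (ENNReal.ofReal p) (ν.restrict U) ≤ ENNReal.ofReal K) :
    ‖avg μ t f x - f x‖ ≤ R * K / (1 - finrank ℝ E / p) * t ^ (1 - finrank ℝ E / p : ℝ) := by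
  have hR := nonneg_of_ae_norm_le hμ
  have hα : -1 < -(finrank ℝ E / p : ℝ) := neg_lt_neg ((div_lt_one (by positivity)).2 hdp)
  choose f' hf' hf'_le using exists_hasDerivAt_avg hμ hf x
  calc ‖avg μ t f x - f x‖ = ‖avg μ t f x - avg μ 0 f x‖ := by rw [avg_zero_left]
    _ ≤ ∫ τ in 0..t, R * K * τ ^ (-(finrank ℝ E / p : ℝ)) := by
      refine norm_sub_le_integral_of_norm_deriv_le_of_le ht.le
        (fun τ _ => (hf' τ).continuousAt.continuousWithinAt)
        (fun τ _ => (hf' τ).differentiableAt.differentiableWithinAt)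
        (.of_forall fun τ hτ => ?_) ((intervalIntegral.intervalIntegrable_rpow' hα).const_mul _)
      have hU' : closedBall x (R * τ) ⊆ U :=
        (closedBall_subset_closedBall (by gcongr; exact hτ.2.le)).trans hU
      rw [(hf' τ).deriv, mul_assoc, mul_comm K]
      exact (hf'_le τ).trans (mul_le_mul_of_nonneg_left (avg_norm_le_of_eLpNorm_le hK0 hμν hμ hp
        hτ.1 hUm hU' (hf.continuous_fderiv one_ne_zero) hK) hR)
    _ = R * K / (1 - finrank ℝ E / p) * t ^ (1 - finrank ℝ E / p : ℝ) := by
      rw [intervalIntegral.integral_const_mul, integral_rpow (.inl hα),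
        show -(finrank ℝ E / p : ℝ) + 1 = 1 - finrank ℝ E / p by ring, Real.zero_rpow (by linarith)]
      ring

lemma norm_le_of_eLpNorm_le_of_eLpNorm_fderiv_le (hK₀0 : 0 ≤ K₀) (hK0 : 0 ≤ K) (hμν : μ ≤ ν)
    (hμ : ∀ᵐ z ∂μ, ‖z‖ ≤ R) (hp : 1 ≤ p) (hdp : finrank ℝ E < p) (ht : 0 < t)
    (hUm : MeasurableSet U) (hU : closedBall x (R * t) ⊆ U) (hf : ContDiff ℝ 1 f)
    (hK₀ : eLpNorm f (ENNReal.ofReal p) (ν.restrict U) ≤ ENNReal.ofReal K₀)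
    (hK : eLpNorm (fderiv ℝ f) (ENNReal.ofReal p) (ν.restrict U) ≤ ENNReal.ofReal K) :
    ‖f x‖ ≤ t ^ (-(finrank ℝ E / p : ℝ)) * K₀ +
      R * K / (1 - finrank ℝ E / p) * t ^ (1 - finrank ℝ E / p : ℝ) :=
  calc ‖f x‖ ≤ ‖avg μ t f x‖ + ‖avg μ t f x - f x‖ := norm_le_norm_add_norm_sub ..
    _ ≤ avg μ t (fun y => ‖f y‖) x + ‖avg μ t f x - f x‖ := by
      gcongr
      exact norm_integral_le_integral_norm _
    _ ≤ _ := add_le_add (avg_norm_le_of_eLpNorm_le hK₀0 hμν hμ hp ht hUm hU hf.continuous hK₀)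
      (norm_avg_sub_le_of_eLpNorm_fderiv_le hK0 hμν hμ hp hdp ht hUm hU hf hK)

lemma norm_avg_sub_le_of_mem_closedBall {y : E} (hK0 : 0 ≤ K) (hμν : μ ≤ ν)
    (hμ : ∀ᵐ z ∂μ, ‖z‖ ≤ R) (hp : 1 ≤ p) (hdp : finrank ℝ E < p) (ht : 0 < t)
    (hUm : MeasurableSet U) (hU : ∀ y ∈ closedBall x (R * t), closedBall y (R * t) ⊆ U)
    (hf : ContDiff ℝ 1 f)
    (hK : eLpNorm (fderiv ℝ f) (ENNReal.ofReal p) (ν.restrict U) ≤ ENNReal.ofReal K)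
    (hy : y ∈ closedBall x (R * t)) :
    ‖avg μ t f x - f y‖ ≤
      (R * K + R * K / (1 - finrank ℝ E / p)) * t ^ (1 - finrank ℝ E / p : ℝ) := by
  have hR := nonneg_of_ae_norm_le hμ
  have hderiv : ∀ y ∈ closedBall x (R * t),
      ‖fderiv ℝ (avg μ t f) y‖ ≤ t ^ (-(finrank ℝ E / p : ℝ)) * K := fun y hy => by
    rw [fderiv_avg hμ hf]
    exact (norm_integral_le_integral_norm _).trans (avg_norm_le_of_eLpNorm_le hK0 hμν hμ hp ht hUm
      (hU y hy) (hf.continuous_fderiv one_ne_zero) hK)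
  have hlip := (convex_closedBall x (R * t)).norm_image_sub_le_of_norm_fderiv_le
    (fun y _ => differentiable_avg hμ hf t y) hderiv hy (mem_closedBall_self (by positivity))
  have hxy : ‖x - y‖ ≤ R * t := by rwa [← dist_eq_norm, dist_comm]
  calc ‖avg μ t f x - f y‖ ≤ ‖avg μ t f x - avg μ t f y‖ + ‖avg μ t f y - f y‖ :=
        norm_sub_le_norm_sub_add_norm_sub ..
    _ ≤ t ^ (-(finrank ℝ E / p : ℝ)) * K * (R * t) +
          R * K / (1 - finrank ℝ E / p) * t ^ (1 - finrank ℝ E / p : ℝ) := by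
      gcongr
      · exact hlip.trans (by gcongr)
      · exact norm_avg_sub_le_of_eLpNorm_fderiv_le hK0 hμν hμ hp hdp ht hUm (hU y hy) hf hK
    _ = _ := by
      rw [sub_eq_add_neg 1, Real.rpow_add ht, Real.rpow_one]
      ring

end Morrey

section Coercive

open scoped Matrix

variable {ι : Type*} [Fintype ι] {A B : Matrix ι ι ℝ} {c : ℝ}

/-- The quadratic form of `A` is at least `c` times the squared Euclidean norm. -/
def IsCoerciveWith (c : ℝ) (A : Matrix ι ι ℝ) : Prop :=
  ∀ v : EuclideanSpace ℝ ι, c * ‖v‖ ^ 2 ≤ v.ofLp ⬝ᵥ A *ᵥ v.ofLp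

lemma sum_sum_mul_mul_eq_dotProduct_mulVec (A : Matrix ι ι ℝ) (v : ι → ℝ) :
    ∑ k, ∑ l, A k l * v k * v l = v ⬝ᵥ A *ᵥ v := by
  simp only [dotProduct, Matrix.mulVec, Finset.mul_sum]
  exact Finset.sum_congr rfl fun k _ => Finset.sum_congr rfl fun l _ => by ring

namespace IsCoerciveWith

lemma dotProduct_mulVec_pos (h : IsCoerciveWith c A) (hc : 0 < c) {v : ι → ℝ} (hv : v ≠ 0) :
    0 < v ⬝ᵥ A *ᵥ v := by
  have hv' : WithLp.toLp 2 v ≠ 0 := by simpa using hv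
  exact lt_of_lt_of_le (by positivity) (h (WithLp.toLp 2 v))

lemma posDef (h : IsCoerciveWith c A) (hc : 0 < c) (hA : A.IsSymm) : A.PosDef :=
  .of_dotProduct_mulVec_pos hA fun _ hv => h.dotProduct_mulVec_pos hc hv

variable [DecidableEq ι]

lemma isUnit_det (h : IsCoerciveWith c A) (hc : 0 < c) : IsUnit A.det := by
  refine isUnit_iff_ne_zero.2 fun h0 => ?_
  obtain ⟨v, hv, hAv⟩ := Matrix.exists_mulVec_eq_zero_iff.2 h0
  exact (h.dotProduct_mulVec_pos hc hv).ne' (by rw [hAv, dotProduct_zero])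

lemma abs_inv_apply_le (h : IsCoerciveWith c A) (hc : 0 < c) (i j : ι) : |A⁻¹ i j| ≤ 1 / c := by
  set w : EuclideanSpace ℝ ι := WithLp.toLp 2 (A⁻¹ *ᵥ Pi.single j 1) with hw_def
  have hAw : A *ᵥ w.ofLp = Pi.single j 1 := by
    rw [hw_def, Matrix.mulVec_mulVec, Matrix.mul_nonsing_inv A (h.isUnit_det hc), Matrix.one_mulVec]
  have hw : c * ‖w‖ ^ 2 ≤ ‖w‖ := by
    calc c * ‖w‖ ^ 2 ≤ w j := by simpa [hAw] using h w
      _ ≤ ‖w‖ := (le_abs_self _).trans (PiLp.norm_apply_le w j)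
  have hw' : ‖w‖ ≤ 1 / c := by
    rw [le_div_iff₀ hc]
    by_contra! hlt
    nlinarith [norm_nonneg w]
  simpa [hw_def] using (PiLp.norm_apply_le w i).trans hw'

lemma abs_inv_sub_inv_apply_le (hA : IsCoerciveWith c A) (hB : IsCoerciveWith c B) (hc : 0 < c)
    {δ : ℝ} (hδ : ∀ i j, |A i j - B i j| ≤ δ) (i j : ι) :
    |A⁻¹ i j - B⁻¹ i j| ≤ (Fintype.card ι / c) ^ 2 * δ := by
  have hinv : A⁻¹ - B⁻¹ = A⁻¹ * (B - A) * B⁻¹ := Matrix.inv_sub_inv <| by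
    simp only [Matrix.isUnit_iff_isUnit_det, hA.isUnit_det hc, hB.isUnit_det hc]
  have hterm (k l : ι) : |A⁻¹ i l * (B - A) l k * B⁻¹ k j| ≤ 1 / c * δ * (1 / c) := by
    rw [abs_mul, abs_mul, Matrix.sub_apply, abs_sub_comm]
    have hδ₀ : 0 ≤ δ := (abs_nonneg _).trans (hδ i j)
    gcongr
    exacts [hA.abs_inv_apply_le hc i l, hδ l k, hB.abs_inv_apply_le hc k j]
  calc |A⁻¹ i j - B⁻¹ i j| = |∑ k, ∑ l, A⁻¹ i l * (B - A) l k * B⁻¹ k j| := by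
        rw [← Matrix.sub_apply, hinv]
        simp only [Matrix.mul_apply, Finset.sum_mul]
    _ ≤ ∑ _k : ι, ∑ _l : ι, 1 / c * δ * (1 / c) :=
        (Finset.abs_sum_le_sum_abs ..).trans <| Finset.sum_le_sum fun k _ =>
          (Finset.abs_sum_le_sum_abs ..).trans <| Finset.sum_le_sum fun l _ => hterm k l
    _ = (Fintype.card ι / c) ^ 2 * δ := by
        simp only [Finset.sum_const, Finset.card_univ, nsmul_eq_mul]
        ring

end IsCoerciveWith

end Coercive

section InverseDerivative

open scoped Matrix Matrix.Norms.Operator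

lemma hasFDerivAt_matrix_inv_apply {ι E : Type*} [Fintype ι] [DecidableEq ι] [NormedAddCommGroup E]
    [NormedSpace ℝ E] {G : E → Matrix ι ι ℝ} {G' : ι → ι → E →L[ℝ] ℝ} {x : E}
    (hG : ∀ a b, HasFDerivAt (fun y => G y a b) (G' a b) x) (hx : IsUnit (G x).det) (i j : ι) :
    HasFDerivAt (fun y => (G y)⁻¹ i j)
      (-∑ a, ∑ b, ((G x)⁻¹ i a * (G x)⁻¹ b j) • G' a b) x := by
  obtain ⟨u, hu⟩ := (Matrix.isUnit_iff_isUnit_det _).2 hx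
  have hGx : HasFDerivAt G (ContinuousLinearMap.pi fun a => ContinuousLinearMap.pi (G' a)) x :=
    hasFDerivAt_pi.2 fun a => hasFDerivAt_pi.2 (hG a)
  have h := ((hu ▸ hasFDerivAt_ringInverse u).comp x hGx)
  have hij := hasFDerivAt_pi'.1 (hasFDerivAt_pi'.1 h i) j
  rw [show (fun y => (G y)⁻¹ i j) = fun y => (Ring.inverse ∘ G) y i j by
    simp only [Matrix.nonsing_inv_eq_ringInverse, Function.comp_apply]]
  refine hij.congr_fderiv ?_
  ext v
  have hu' : (↑u⁻¹ : Matrix ι ι ℝ) = (G x)⁻¹ := by rw [Matrix.coe_units_inv, hu]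
  have hmul : ((G x)⁻¹ * (Matrix.of fun a b => G' a b v) * (G x)⁻¹) i j =
      ∑ a, ∑ b, (G x)⁻¹ i a * (G x)⁻¹ b j * G' a b v := by
    simp only [Matrix.mul_apply, Finset.sum_mul, Matrix.of_apply]
    rw [Finset.sum_comm]
    exact Finset.sum_congr rfl fun a _ => Finset.sum_congr rfl fun b _ => by ring
  calc _ = -((G x)⁻¹ * (Matrix.of fun a b => G' a b v) * (G x)⁻¹) i j := by rw [← hu']; rfl
    _ = _ := by rw [hmul]; simp

end InverseDerivative

section QuasilinearStructure

variable {n : ℕ} {G G₁ G₂ : Eucl n → Matrix (Fin n) (Fin n) ℝ} {x : Eucl n}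

/-- Arrays of components with two indices, with the maximum norm. -/
abbrev Tensor2 (n : ℕ) : Type := Fin n → Fin n → ℝ

/-- Arrays of components with three indices, with the maximum norm. -/
abbrev Tensor3 (n : ℕ) : Type := Fin n → Tensor2 n

/-- Arrays of components with four indices, with the maximum norm. -/
abbrev Tensor4 (n : ℕ) : Type := Fin n → Tensor3 n

/-- The components `g^{ij}`, as a normed array rather than as a matrix. -/
noncomputable def inverseMetric (G : Eucl n → Matrix (Fin n) (Fin n) ℝ) (x : Eucl n) : Tensor2 n :=
  fun i j => (G x)⁻¹ i j

/-- The array of first derivatives, `metricDeriv G x l a b = ∂ₗ g_{ab}(x)`. -/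
noncomputable def metricDeriv (G : Eucl n → Matrix (Fin n) (Fin n) ℝ) (x : Eucl n) : Tensor3 n :=
  fun l a b => partialDeriv l (fun y => G y a b) x

/-- The array of second derivatives, `metricHess G x m l a b = ∂ₘ ∂ₗ g_{ab}(x)`. -/
noncomputable def metricHess (G : Eucl n → Matrix (Fin n) (Fin n) ℝ) (x : Eucl n) : Tensor4 n :=
  fun m l a b => partialDeriv m (fun y => metricDeriv G y l a b) x

/-- The array of curvature components, `riemTensor G x ρ σ μ ν = R^ρ_{σμν}(x)`. -/
noncomputable def riemTensor (G : Eucl n → Matrix (Fin n) (Fin n) ℝ) (x : Eucl n) : Tensor4 n :=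
  fun ρ σ μ ν => riemComp G ρ σ μ ν x

/-- The Christoffel symbols `Γⁱₖₗ` as a bilinear function of the inverse metric `J` and of the first
derivatives `D` of the metric. -/
noncomputable def christoffelSymbol (J : Tensor2 n) (D : Tensor3 n) : Tensor3 n :=
  fun i k l => (1 / 2 : ℝ) * ∑ m, J i m * (D l m k + D k m l - D m k l)

/-- The first derivatives `∂ₘ g^{ij}` of the inverse metric as a function of the inverse metric `J`
and of the first derivatives `D` of the metric. -/
noncomputable def inverseDeriv (J : Tensor2 n) (D : Tensor3 n) : Tensor3 n :=
  fun m i j => -∑ a, ∑ b, J i a * J b j * D m a b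

/-- The part of the curvature `R^ρ_{σμν}` that contains the second derivatives `H` of the metric;
`J` is the inverse metric. -/
noncomputable def principalPart (J : Tensor2 n) (H : Tensor4 n) : Tensor4 n :=
  fun ρ σ μ ν => christoffelSymbol J (H μ) ρ ν σ - christoffelSymbol J (H ν) ρ μ σ

/-- The part of the curvature `R^ρ_{σμν}` that is quadratic in the first derivatives `D` of the
metric; `J` is the inverse metric. -/
noncomputable def lowerOrderPart (J : Tensor2 n) (D : Tensor3 n) : Tensor4 n :=
  fun ρ σ μ ν => christoffelSymbol (inverseDeriv J D μ) D ρ ν σ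
    - christoffelSymbol (inverseDeriv J D ν) D ρ μ σ
    + ∑ κ, (christoffelSymbol J D ρ μ κ * christoffelSymbol J D κ ν σ
      - christoffelSymbol J D ρ ν κ * christoffelSymbol J D κ μ σ)

lemma contDiff_lowerOrderPart {m : WithTop ℕ∞} :
    ContDiff ℝ m fun q : Tensor2 n × Tensor3 n => lowerOrderPart q.1 q.2 := by
  simp only [contDiff_pi]
  intro ρ σ μ ν
  simp only [lowerOrderPart, christoffelSymbol, inverseDeriv]
  fun_prop

lemma continuous_lowerOrderPart :
    Continuous fun q : Tensor2 n × Tensor3 n => lowerOrderPart q.1 q.2 :=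
  (contDiff_lowerOrderPart (m := 0)).continuous

/-- The principal part of the curvature as a continuous bilinear map. -/
noncomputable def principalPartCLM (n : ℕ) : Tensor2 n →L[ℝ] Tensor4 n →L[ℝ] Tensor4 n :=
  (LinearMap.mk₂ ℝ principalPart
    (fun J₁ J₂ H => by
      ext ρ σ μ ν
      simp only [principalPart, christoffelSymbol, Pi.add_apply, add_mul, Finset.sum_add_distrib]
      ring)
    (fun c J H => by
      ext ρ σ μ ν
      simp only [principalPart, christoffelSymbol, Pi.smul_apply, smul_eq_mul, mul_assoc,
        ← Finset.mul_sum]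
      ring)
    (fun J H₁ H₂ => by
      ext ρ σ μ ν
      simp only [principalPart, christoffelSymbol, Pi.add_apply, ← mul_add, ← mul_sub,
        ← Finset.sum_add_distrib, ← Finset.sum_sub_distrib]
      congr! 2 with m
      ring)
    (fun c J H => by
      ext ρ σ μ ν
      simp only [principalPart, christoffelSymbol, Pi.smul_apply, smul_eq_mul, ← mul_sub,
        ← Finset.sum_sub_distrib, mul_left_comm c, Finset.mul_sum]
      congr! 1 with m
      ring)).toContinuousBilinearMap

lemma christoffel_eq (G : Eucl n → Matrix (Fin n) (Fin n) ℝ) (i k l : Fin n) (x : Eucl n) :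
    christoffel G i k l x = christoffelSymbol (inverseMetric G x) (metricDeriv G x) i k l := rfl

lemma hasFDerivAt_inverseMetric_apply (hG : ∀ a b, DifferentiableAt ℝ (fun y => G y a b) x)
    (hx : IsUnit (G x).det) (i j : Fin n) :
    HasFDerivAt (fun y => inverseMetric G y i j)
      (-∑ a, ∑ b, ((G x)⁻¹ i a * (G x)⁻¹ b j) • fderiv ℝ (fun y => G y a b) x) x :=
  hasFDerivAt_matrix_inv_apply (fun a b => (hG a b).hasFDerivAt) hx i j

lemma differentiableAt_inverseMetric (hG : ∀ a b, DifferentiableAt ℝ (fun y => G y a b) x)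
    (hx : IsUnit (G x).det) : DifferentiableAt ℝ (inverseMetric G) x :=
  differentiableAt_pi.2 fun i => differentiableAt_pi.2 fun j =>
    (hasFDerivAt_inverseMetric_apply hG hx i j).differentiableAt

lemma partialDeriv_inverseMetric (hG : ∀ a b, DifferentiableAt ℝ (fun y => G y a b) x)
    (hx : IsUnit (G x).det) (m i j : Fin n) :
    partialDeriv m (fun y => inverseMetric G y i j) x =
      inverseDeriv (inverseMetric G x) (metricDeriv G x) m i j := by
  rw [partialDeriv, (hasFDerivAt_inverseMetric_apply hG hx i j).fderiv]
  simp [inverseDeriv, metricDeriv, partialDeriv, inverseMetric]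

lemma partialDeriv_christoffel (hG : ∀ a b, DifferentiableAt ℝ (fun y => G y a b) x)
    (hG' : DifferentiableAt ℝ (metricDeriv G) x) (hx : IsUnit (G x).det) (μ i k l : Fin n) :
    partialDeriv μ (christoffel G i k l) x =
      christoffelSymbol (inverseMetric G x) (metricHess G x μ) i k l +
        christoffelSymbol (inverseDeriv (inverseMetric G x) (metricDeriv G x) μ)
          (metricDeriv G x) i k l := by
  have hJ (m : Fin n) : HasFDerivAt (fun y => inverseMetric G y i m) _ x :=
    (hasFDerivAt_inverseMetric_apply hG hx i m).differentiableAt.hasFDerivAt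
  have hD (l a b : Fin n) : HasFDerivAt (fun y => metricDeriv G y l a b) _ x :=
    (differentiableAt_pi.1 (differentiableAt_pi.1 (differentiableAt_pi.1 hG' l) a) b).hasFDerivAt
  have h : HasFDerivAt (christoffel G i k l) _ x := (HasFDerivAt.fun_sum (u := Finset.univ)
    fun m _ => (hJ m).mul (((hD l m k).add (hD k m l)).sub (hD m k l))).const_mul (1 / 2)
  rw [partialDeriv, h.fderiv]
  simp only [christoffelSymbol, ← partialDeriv_inverseMetric hG hx, metricHess, partialDeriv,
    ← mul_add, ← Finset.sum_add_distrib]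
  simp only [Pi.sub_apply, Pi.add_apply, smul_apply, sum_apply, add_apply, sub_apply, smul_eq_mul]
  exact congrArg _ (Finset.sum_congr rfl fun m _ => by ring)

lemma riemTensor_eq (hG : ∀ a b, DifferentiableAt ℝ (fun y => G y a b) x)
    (hG' : DifferentiableAt ℝ (metricDeriv G) x) (hx : IsUnit (G x).det) :
    riemTensor G x = principalPart (inverseMetric G x) (metricHess G x) +
      lowerOrderPart (inverseMetric G x) (metricDeriv G x) := by
  ext ρ σ μ ν
  simp only [riemTensor, riemComp, partialDeriv_christoffel hG hG' hx, christoffel_eq,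
    Pi.add_apply, principalPart, lowerOrderPart]
  ring

lemma contDiff_partialDeriv {m : WithTop ℕ∞} {f : Eucl n → ℝ} (hf : ContDiff ℝ (m + 1) f)
    (i : Fin n) : ContDiff ℝ m (partialDeriv i f) :=
  (hf.fderiv_right le_rfl).clm_apply contDiff_const

lemma contDiff_metricDeriv {m : WithTop ℕ∞} (hG : ∀ a b, ContDiff ℝ (m + 1) fun y => G y a b) :
    ContDiff ℝ m (metricDeriv G) :=
  contDiff_pi.2 fun l => contDiff_pi.2 fun a => contDiff_pi.2 fun b =>
    contDiff_partialDeriv (hG a b) l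

lemma continuous_metricHess (hG : ∀ a b, ContDiff ℝ 2 fun y => G y a b) :
    Continuous (metricHess G) := by
  have h : ContDiff ℝ (0 + 1) (metricDeriv G) :=
    contDiff_metricDeriv (by simpa [one_add_one_eq_two])
  exact continuous_pi fun m => continuous_pi fun l => continuous_pi fun a => continuous_pi fun b =>
    (contDiff_partialDeriv (contDiff_pi.1 (contDiff_pi.1 (contDiff_pi.1 h l) a) b) m).continuous

lemma continuousOn_inverseMetric {s : Set (Eucl n)} (hG : ∀ a b, Differentiable ℝ fun y => G y a b)
    (hs : ∀ x ∈ s, IsUnit (G x).det) : ContinuousOn (inverseMetric G) s := fun x hx =>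
  (differentiableAt_inverseMetric (fun a b => hG a b x)
    (hs x hx)).continuousAt.continuousWithinAt

lemma continuousOn_principalPart {s : Set (Eucl n)} {J : Eucl n → Tensor2 n}
    {H : Eucl n → Tensor4 n} (hJ : ContinuousOn J s) (hH : ContinuousOn H s) :
    ContinuousOn (fun y => principalPart (J y) (H y)) s :=
  ((principalPartCLM n).continuous.comp_continuousOn hJ).clm_apply hH

lemma continuousOn_lowerOrderPart {s : Set (Eucl n)} {J : Eucl n → Tensor2 n}
    {D : Eucl n → Tensor3 n} (hJ : ContinuousOn J s) (hD : ContinuousOn D s) :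
    ContinuousOn (fun y => lowerOrderPart (J y) (D y)) s := by
  have h := continuous_lowerOrderPart.comp_continuousOn' (hJ.prodMk hD)
  exact h

lemma continuousOn_riemTensor {s : Set (Eucl n)} (hG : ∀ a b, ContDiff ℝ 2 fun y => G y a b)
    (hs : ∀ x ∈ s, IsUnit (G x).det) : ContinuousOn (riemTensor G) s := by
  have hdiff (a b : Fin n) : Differentiable ℝ fun y => G y a b :=
    (hG a b).differentiable two_ne_zero
  have hD : ContDiff ℝ 1 (metricDeriv G) := contDiff_metricDeriv (by simpa [one_add_one_eq_two])
  have hJ := continuousOn_inverseMetric hdiff hs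
  exact ((continuousOn_principalPart hJ (continuous_metricHess hG).continuousOn).add
    (continuousOn_lowerOrderPart hJ hD.continuous.continuousOn)).congr fun y hy =>
      riemTensor_eq (fun a b => hdiff a b y) (hD.differentiable one_ne_zero y) (hs y hy)

lemma metricDeriv_congr (h : G₁ =ᶠ[𝓝 x] G₂) : metricDeriv G₁ =ᶠ[𝓝 x] metricDeriv G₂ := by
  filter_upwards [h.eventuallyEq_nhds] with y hy
  ext l a b
  have hab : (fun z => G₁ z a b) =ᶠ[𝓝 y] fun z => G₂ z a b := hy.mono fun z hz => congrFun₂ hz a b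
  rw [metricDeriv, metricDeriv, partialDeriv, partialDeriv, hab.fderiv_eq]

lemma metricHess_congr (h : G₁ =ᶠ[𝓝 x] G₂) : metricHess G₁ x = metricHess G₂ x := by
  ext m l a b
  have hlab : (fun y => metricDeriv G₁ y l a b) =ᶠ[𝓝 x] fun y => metricDeriv G₂ y l a b :=
    (metricDeriv_congr h).mono fun y hy => by simp only [hy]
  rw [metricHess, metricHess, partialDeriv, partialDeriv, hlab.fderiv_eq]

lemma christoffel_congr (h : G₁ =ᶠ[𝓝 x] G₂) (i k l : Fin n) :
    christoffel G₁ i k l =ᶠ[𝓝 x] christoffel G₂ i k l := by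
  filter_upwards [h, metricDeriv_congr h] with y hy hy'
  have hJ : inverseMetric G₁ y = inverseMetric G₂ y := by ext; rw [inverseMetric, inverseMetric, hy]
  rw [christoffel_eq, christoffel_eq, hJ, hy']

lemma riemTensor_congr (h : G₁ =ᶠ[𝓝 x] G₂) : riemTensor G₁ x = riemTensor G₂ x := by
  ext ρ σ μ ν
  simp only [riemTensor, riemComp, partialDeriv, (christoffel_congr h _ _ _).eq_of_nhds,
    (christoffel_congr h _ _ _).fderiv_eq]

end QuasilinearStructure

section Contraction

variable {n : ℕ}

/-- The contraction `R ↦ R^ρ_{σμν} w₀^μ w₁^ν w₂^σ w₃_ρ`. -/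
noncomputable def contraction (w : Fin 4 → Fin n → ℝ) : Tensor4 n →L[ℝ] ℝ :=
  LinearMap.toContinuousLinearMap
    { toFun R := ∑ ρ, ∑ σ, ∑ μ, ∑ ν, R ρ σ μ ν * w 0 μ * w 1 ν * w 2 σ * w 3 ρ
      map_add' R₁ R₂ := by simp only [Pi.add_apply, add_mul, Finset.sum_add_distrib]
      map_smul' c R := by
        simp only [Pi.smul_apply, smul_eq_mul, mul_assoc, Finset.mul_sum, RingHom.id_apply] }

lemma contraction_apply (w : Fin 4 → Fin n → ℝ) (R : Tensor4 n) :
    contraction w R = ∑ ρ, ∑ σ, ∑ μ, ∑ ν, R ρ σ μ ν * w 0 μ * w 1 ν * w 2 σ * w 3 ρ := rfl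

lemma riem_eq_contraction (G : Eucl n → Matrix (Fin n) (Fin n) ℝ) (x : Eucl n)
    (w : Fin 4 → Fin n → ℝ) : riem G x w = contraction w (riemTensor G x) := rfl

lemma norm_contraction_le (w : Fin 4 → Fin n → ℝ) (R : Tensor4 n) :
    ‖contraction w R‖ ≤ n ^ 4 * ‖w‖ ^ 4 * ‖R‖ := by
  have hw (i : Fin 4) (j : Fin n) : ‖w i j‖ ≤ ‖w‖ :=
    (norm_le_pi_norm (w i) j).trans (norm_le_pi_norm w i)
  have hR (ρ σ μ ν : Fin n) : ‖R ρ σ μ ν‖ ≤ ‖R‖ :=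
    (norm_le_pi_norm (R ρ σ μ) ν).trans <| (norm_le_pi_norm (R ρ σ) μ).trans <|
      (norm_le_pi_norm (R ρ) σ).trans (norm_le_pi_norm R ρ)
  have hterm (ρ σ μ ν : Fin n) :
      ‖R ρ σ μ ν * w 0 μ * w 1 ν * w 2 σ * w 3 ρ‖ ≤ ‖R‖ * ‖w‖ * ‖w‖ * ‖w‖ * ‖w‖ := by
    simp only [norm_mul]
    gcongr <;> apply_rules
  calc ‖contraction w R‖ ≤ ∑ _ρ : Fin n, ∑ _σ : Fin n, ∑ _μ : Fin n, ∑ _ν : Fin n,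
        ‖R‖ * ‖w‖ * ‖w‖ * ‖w‖ * ‖w‖ := by
        rw [contraction_apply]
        exact norm_sum_le_of_le _ fun ρ _ => norm_sum_le_of_le _ fun σ _ =>
          norm_sum_le_of_le _ fun μ _ => norm_sum_le_of_le _ fun ν _ => hterm ρ σ μ ν
    _ = n ^ 4 * ‖w‖ ^ 4 * ‖R‖ := by
        simp only [Finset.sum_const, Finset.card_univ, Fintype.card_fin, nsmul_eq_mul]
        ring

end Contraction

section OperatorNorm

lemma norm_le_of_norm_apply_stdVec_le {n : ℕ} {V : Type*} [NormedAddCommGroup V] [NormedSpace ℝ V]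
    {L : Eucl n →L[ℝ] V} {C : ℝ} (hC : 0 ≤ C) (hL : ∀ j, ‖L (stdVec j)‖ ≤ C) : ‖L‖ ≤ n * C := by
  refine L.opNorm_le_bound (by positivity) fun v => ?_
  have hv : v = ∑ j, v j • stdVec j := by
    ext i
    simp [stdVec, Finset.sum_apply, Pi.single_apply]
  calc ‖L v‖ = ‖∑ j, v j • L (stdVec j)‖ := by
        conv_lhs => rw [hv, map_sum]
        simp only [map_smul]
    _ ≤ ∑ _j : Fin n, ‖v‖ * C := norm_sum_le_of_le _ fun j _ => by
        rw [norm_smul]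
        exact mul_le_mul (PiLp.norm_apply_le v j) (hL j) (norm_nonneg _) (norm_nonneg _)
    _ = n * C * ‖v‖ := by
        simp only [Finset.sum_const, Finset.card_univ, Fintype.card_fin, nsmul_eq_mul]
        ring

end OperatorNorm

section AverageMetric

variable {n : ℕ} {μ : Measure (Eucl n)} {R t c M : ℝ} {F : Eucl n → Matrix (Fin n) (Fin n) ℝ}
  {x : Eucl n}

/-- The componentwise average of a field of matrices. -/
noncomputable def avgMetric (μ : Measure (Eucl n)) (t : ℝ) (F : Eucl n → Matrix (Fin n) (Fin n) ℝ)
    (x : Eucl n) : Matrix (Fin n) (Fin n) ℝ :=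
  Matrix.of fun a b => avg μ t (fun y => F y a b) x

variable [IsProbabilityMeasure μ]

lemma avg_apply {ι : Type*} [Fintype ι] {V : ι → Type*} [∀ i, NormedAddCommGroup (V i)]
    [∀ i, NormedSpace ℝ (V i)] [∀ i, CompleteSpace (V i)] {f : Eucl n → ∀ i, V i}
    (hμ : ∀ᵐ z ∂μ, ‖z‖ ≤ R) (hf : Continuous f) (ht : 0 ≤ t) (i : ι) :
    avg μ t f x i = avg μ t (fun y => f y i) x :=
  (avg_clm_comp hμ ht hf.continuousOn (ContinuousLinearMap.proj i)).symm

lemma partialDeriv_avg {f : Eucl n → ℝ} (hμ : ∀ᵐ z ∂μ, ‖z‖ ≤ R) (ht : 0 ≤ t) (hf : ContDiff ℝ 1 f)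
    (i : Fin n) : partialDeriv i (avg μ t f) = avg μ t (partialDeriv i f) := by
  ext x
  rw [partialDeriv, fderiv_avg hμ hf]
  exact (avg_clm_comp hμ ht (hf.continuous_fderiv one_ne_zero).continuousOn
    (ContinuousLinearMap.apply ℝ ℝ (stdVec i))).symm

lemma metricDeriv_avgMetric (hμ : ∀ᵐ z ∂μ, ‖z‖ ≤ R) (ht : 0 ≤ t)
    (hF : ∀ a b, ContDiff ℝ 1 fun y => F y a b) :
    metricDeriv (avgMetric μ t F) = avg μ t (metricDeriv F) := by
  have hD : Continuous (metricDeriv F) := (contDiff_metricDeriv (m := 0) (by simpa)).continuous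
  ext x l a b
  rw [avg_apply hμ hD ht, avg_apply hμ (by fun_prop) ht, avg_apply hμ (by fun_prop) ht]
  exact congrFun (partialDeriv_avg hμ ht (hF a b) l) x

lemma metricHess_avgMetric (hμ : ∀ᵐ z ∂μ, ‖z‖ ≤ R) (ht : 0 ≤ t)
    (hF : ∀ a b, ContDiff ℝ 2 fun y => F y a b) :
    metricHess (avgMetric μ t F) = avg μ t (metricHess F) := by
  have hH : Continuous (metricHess F) := continuous_metricHess hF
  have hD : ContDiff ℝ 1 (metricDeriv F) := contDiff_metricDeriv (by simpa [one_add_one_eq_two])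
  ext x m l a b
  rw [avg_apply hμ hH ht, avg_apply hμ (by fun_prop) ht, avg_apply hμ (by fun_prop) ht,
    avg_apply hμ (by fun_prop) ht, metricHess,
    metricDeriv_avgMetric hμ ht fun a b => (hF a b).of_le one_le_two]
  have hcomp : (fun y => avg μ t (metricDeriv F) y l a b) =
      avg μ t fun y => metricDeriv F y l a b := by
    ext y
    have hD' := hD.continuous
    rw [avg_apply hμ hD' ht, avg_apply hμ (by fun_prop) ht, avg_apply hμ (by fun_prop) ht]
  rw [hcomp, partialDeriv_avg hμ ht]
  · rfl
  · exact contDiff_pi.1 (contDiff_pi.1 (contDiff_pi.1 hD l) a) b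

lemma isCoerciveWith_avgMetric (hμ : ∀ᵐ z ∂μ, ‖z‖ ≤ R) (ht : 0 ≤ t)
    (hF : ∀ a b, ContinuousOn (fun y => F y a b) (closedBall x (R * t)))
    (hc : ∀ y ∈ closedBall x (R * t), IsCoerciveWith c (F y)) :
    IsCoerciveWith c (avgMetric μ t F x) := fun v => by
  have hint (f : Eucl n → ℝ) (hf : ContinuousOn f (closedBall x (R * t))) :
      Integrable (fun z => f (x - t • z)) μ :=
    integrable_comp_sub_smul hμ ht hf
  calc c * ‖v‖ ^ 2 = ∫ _z, c * ‖v‖ ^ 2 ∂μ := by simp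
    _ ≤ ∫ z, ∑ k, ∑ l, F (x - t • z) k l * v k * v l ∂μ := by
      refine integral_mono_ae (integrable_const _)
        (hint (fun y => ∑ k, ∑ l, F y k l * v k * v l) (by fun_prop)) ?_
      filter_upwards [ae_sub_smul_mem_closedBall hμ ht x] with z hz
      exact (hc _ hz v).trans_eq (sum_sum_mul_mul_eq_dotProduct_mulVec ..).symm
    _ = ∑ k, ∑ l, avg μ t (fun y => F y k l) x * v k * v l := by
      simp only [avg]
      rw [integral_finsetSum _ fun k _ => hint (fun y => ∑ l, F y k l * v k * v l) (by fun_prop)]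
      refine Finset.sum_congr rfl fun k _ => ?_
      rw [integral_finsetSum _ fun l _ => hint (fun y => F y k l * v k * v l) (by fun_prop)]
      simp only [integral_mul_const]
    _ = _ := sum_sum_mul_mul_eq_dotProduct_mulVec (avgMetric μ t F x) v

lemma norm_inverseMetric_le (hc0 : 0 < c) (hc : IsCoerciveWith c (F x)) :
    ‖inverseMetric F x‖ ≤ 1 / c :=
  (pi_norm_le_iff_of_nonneg (by positivity)).2 fun i =>
    (pi_norm_le_iff_of_nonneg (by positivity)).2 fun j => hc.abs_inv_apply_le hc0 i j

lemma abs_sub_le_of_norm_metricDeriv_le {s : Set (Eucl n)} (hs : Convex ℝ s)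
    (hF : ∀ a b, Differentiable ℝ fun y => F y a b) (hM0 : 0 ≤ M)
    (hM : ∀ y ∈ s, ‖metricDeriv F y‖ ≤ M) {y z : Eucl n} (hy : y ∈ s) (hz : z ∈ s) (a b : Fin n) :
    |F y a b - F z a b| ≤ n * M * ‖y - z‖ := by
  refine hs.norm_image_sub_le_of_norm_fderiv_le (f := fun y => F y a b) (fun y _ => hF a b y)
    (fun y hy => norm_le_of_norm_apply_stdVec_le hM0 fun l => ?_) hz hy
  exact (norm_le_pi_norm (metricDeriv F y l a) b).trans <|
    (norm_le_pi_norm (metricDeriv F y l) a).trans <| (norm_le_pi_norm _ l).trans (hM y hy)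

lemma norm_inverseMetric_avgMetric_sub_le (hμ : ∀ᵐ z ∂μ, ‖z‖ ≤ R) (ht : 0 ≤ t)
    (hF : ∀ a b, ContDiff ℝ 1 fun y => F y a b) (hc0 : 0 < c)
    (hc : ∀ y ∈ closedBall x (R * t), IsCoerciveWith c (F y)) (hM0 : 0 ≤ M)
    (hM : ∀ y ∈ closedBall x (R * t), ‖metricDeriv F y‖ ≤ M) {y : Eucl n}
    (hy : y ∈ closedBall x (R * t)) :
    ‖inverseMetric (avgMetric μ t F) x - inverseMetric F y‖ ≤
      (n / c) ^ 2 * (2 * n * M * R) * t := by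
  have hR := nonneg_of_ae_norm_le hμ
  have hF' (a b : Fin n) : Continuous fun y => F y a b := (hF a b).continuous
  have hosc (a b : Fin n) : |avgMetric μ t F x a b - F y a b| ≤ 2 * n * M * R * t := by
    rw [abs_sub_comm]
    refine norm_sub_avg_le hμ ht (hF' a b).continuousOn fun z hz => ?_
    have hyz : ‖y - z‖ ≤ R * t + R * t := by
      rw [← dist_eq_norm]
      exact (dist_triangle_right y z x).trans (add_le_add hy hz)
    calc |F y a b - F z a b| ≤ n * M * ‖y - z‖ :=
          abs_sub_le_of_norm_metricDeriv_le (convex_closedBall x (R * t))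
            (fun a b => (hF a b).differentiable one_ne_zero) hM0 hM hy hz a b
      _ ≤ n * M * (R * t + R * t) := by gcongr
      _ = 2 * n * M * R * t := by ring
  refine (pi_norm_le_iff_of_nonneg (by positivity)).2 fun i =>
    (pi_norm_le_iff_of_nonneg (by positivity)).2 fun j => ?_
  have hcoercive := isCoerciveWith_avgMetric hμ ht (fun a b => (hF' a b).continuousOn) hc
  refine (hcoercive.abs_inv_sub_inv_apply_le (hc y hy) hc0 hosc i j).trans_eq ?_
  rw [Fintype.card_fin]
  ring

lemma norm_principalPart_avg_sub_le (hμ : ∀ᵐ z ∂μ, ‖z‖ ≤ R) (ht : 0 ≤ t)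
    (hF : ∀ a b, ContDiff ℝ 2 fun y => F y a b) (hc0 : 0 < c)
    (hc : ∀ y ∈ closedBall x (R * t), IsCoerciveWith c (F y)) (hM0 : 0 ≤ M)
    (hM : ∀ y ∈ closedBall x (R * t), ‖metricDeriv F y‖ ≤ M) :
    ‖principalPart (inverseMetric (avgMetric μ t F) x) (avg μ t (metricHess F) x) -
        avg μ t (fun y => principalPart (inverseMetric F y) (metricHess F y)) x‖ ≤
      ‖principalPartCLM n‖ * ((n / c) ^ 2 * (2 * n * M * R) * t) *
        avg μ t (fun y => ‖metricHess F y‖) x := by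
  have hF' (a b : Fin n) : ContDiff ℝ 1 fun y => F y a b := (hF a b).of_le one_le_two
  exact norm_bilin_avg_sub_avg_bilin_le hμ ht (principalPartCLM n)
    (continuousOn_inverseMetric (fun a b => (hF' a b).differentiable one_ne_zero)
      fun y hy => (hc y hy).isUnit_det hc0)
    (continuous_metricHess hF).continuousOn
    fun y hy => norm_inverseMetric_avgMetric_sub_le hμ ht hF' hc0 hc hM0 hM hy

lemma exists_lipschitzOnWith_lowerOrderPart (n : ℕ) (ρ : ℝ) :
    ∃ L, LipschitzOnWith L (fun q : Tensor2 n × Tensor3 n => lowerOrderPart q.1 q.2)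
      (closedBall 0 ρ) :=
  contDiff_lowerOrderPart.contDiffOn.exists_lipschitzOnWith (n := 1) one_ne_zero
    (convex_closedBall 0 ρ) (isCompact_closedBall 0 ρ)

lemma norm_lowerOrderPart_avg_sub_le {L : NNReal} {δ : ℝ} (hμ : ∀ᵐ z ∂μ, ‖z‖ ≤ R) (ht : 0 ≤ t)
    (hF : ∀ a b, ContDiff ℝ 2 fun y => F y a b) (hc0 : 0 < c)
    (hc : ∀ y ∈ closedBall x (R * t), IsCoerciveWith c (F y)) (hM0 : 0 ≤ M)
    (hM : ∀ y ∈ closedBall x (R * t), ‖metricDeriv F y‖ ≤ M)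
    (hL : LipschitzOnWith L (fun q : Tensor2 n × Tensor3 n => lowerOrderPart q.1 q.2)
      (closedBall 0 (max (1 / c) M)))
    (hδ : ∀ y ∈ closedBall x (R * t), ‖avg μ t (metricDeriv F) x - metricDeriv F y‖ ≤ δ) :
    ‖lowerOrderPart (inverseMetric (avgMetric μ t F) x) (avg μ t (metricDeriv F) x) -
        avg μ t (fun y => lowerOrderPart (inverseMetric F y) (metricDeriv F y)) x‖ ≤
      L * max ((n / c) ^ 2 * (2 * n * M * R) * t) δ := by
  have hF' (a b : Fin n) : ContDiff ℝ 1 fun y => F y a b := (hF a b).of_le one_le_two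
  have hJ := continuousOn_inverseMetric (fun a b => (hF' a b).differentiable one_ne_zero)
    fun y hy => (hc y hy).isUnit_det hc0
  have hD : Continuous (metricDeriv F) :=
    (contDiff_metricDeriv (m := 0) (by simpa using hF')).continuous
  have hcoercive := isCoerciveWith_avgMetric hμ ht (fun a b => (hF a b).continuous.continuousOn) hc
  have hmem : (inverseMetric (avgMetric μ t F) x, avg μ t (metricDeriv F) x) ∈
      closedBall (0 : Tensor2 n × Tensor3 n) (max (1 / c) M) :=
    mem_closedBall_zero_iff.2 <|
      max_le_max (norm_inverseMetric_le hc0 hcoercive) (norm_avg_le hμ ht hM)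
  refine norm_sub_avg_le hμ ht (continuousOn_lowerOrderPart hJ hD.continuousOn) fun y hy => ?_
  have hmem' : (inverseMetric F y, metricDeriv F y) ∈
      closedBall (0 : Tensor2 n × Tensor3 n) (max (1 / c) M) :=
    mem_closedBall_zero_iff.2 <| max_le_max (norm_inverseMetric_le hc0 (hc y hy)) (hM y hy)
  refine (hL.norm_sub_le hmem hmem').trans (mul_le_mul_of_nonneg_left ?_ L.2)
  exact max_le_max (norm_inverseMetric_avgMetric_sub_le hμ ht hF' hc0 hc hM0 hM hy) (hδ y hy)

lemma riemTensor_avgMetric_sub (hμ : ∀ᵐ z ∂μ, ‖z‖ ≤ R) (ht : 0 ≤ t)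
    (hF : ∀ a b, ContDiff ℝ 2 fun y => F y a b) (hc0 : 0 < c)
    (hc : ∀ y ∈ closedBall x (R * t), IsCoerciveWith c (F y)) :
    riemTensor (avgMetric μ t F) x - avg μ t (riemTensor F) x =
      (principalPart (inverseMetric (avgMetric μ t F) x) (avg μ t (metricHess F) x) -
        avg μ t (fun y => principalPart (inverseMetric F y) (metricHess F y)) x) +
      (lowerOrderPart (inverseMetric (avgMetric μ t F) x) (avg μ t (metricDeriv F) x) -
        avg μ t (fun y => lowerOrderPart (inverseMetric F y) (metricDeriv F y)) x) := by
  have hF' (a b : Fin n) : ContDiff ℝ 1 fun y => F y a b := (hF a b).of_le one_le_two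
  have hdiff (a b : Fin n) : Differentiable ℝ fun y => F y a b :=
    (hF' a b).differentiable one_ne_zero
  have hcoercive := isCoerciveWith_avgMetric hμ ht (fun a b => (hF a b).continuous.continuousOn) hc
  have hdet (y) (hy : y ∈ closedBall x (R * t)) := (hc y hy).isUnit_det hc0
  have hJ := continuousOn_inverseMetric hdiff hdet
  have hD : ContDiff ℝ 1 (metricDeriv F) := contDiff_metricDeriv (by simpa [one_add_one_eq_two])
  have hriem : EqOn (riemTensor F) ((fun y => principalPart (inverseMetric F y) (metricHess F y)) +
      fun y => lowerOrderPart (inverseMetric F y) (metricDeriv F y)) (closedBall x (R * t)) :=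
    fun y hy => riemTensor_eq (fun a b => hdiff a b y) (hD.differentiable one_ne_zero y) (hdet y hy)
  have hriem_avg : riemTensor (avgMetric μ t F) x =
      principalPart (inverseMetric (avgMetric μ t F) x) (avg μ t (metricHess F) x) +
        lowerOrderPart (inverseMetric (avgMetric μ t F) x) (avg μ t (metricDeriv F) x) := by
    rw [← metricHess_avgMetric hμ ht hF, ← metricDeriv_avgMetric hμ ht hF']
    refine riemTensor_eq (fun a b => differentiable_avg hμ (hF' a b) t x) ?_
      (hcoercive.isUnit_det hc0)
    rw [metricDeriv_avgMetric hμ ht hF']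
    exact differentiable_avg hμ hD t x
  rw [hriem_avg, avg_congr hμ ht hriem, avg_add hμ ht
    (continuousOn_principalPart hJ (continuous_metricHess hF).continuousOn)
    (continuousOn_lowerOrderPart hJ hD.continuous.continuousOn), add_sub_add_comm]

lemma norm_riemTensor_avgMetric_sub_le {L : NNReal} {δ : ℝ} (hμ : ∀ᵐ z ∂μ, ‖z‖ ≤ R) (ht : 0 ≤ t)
    (hF : ∀ a b, ContDiff ℝ 2 fun y => F y a b) (hc0 : 0 < c)
    (hc : ∀ y ∈ closedBall x (R * t), IsCoerciveWith c (F y)) (hM0 : 0 ≤ M)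
    (hM : ∀ y ∈ closedBall x (R * t), ‖metricDeriv F y‖ ≤ M)
    (hL : LipschitzOnWith L (fun q : Tensor2 n × Tensor3 n => lowerOrderPart q.1 q.2)
      (closedBall 0 (max (1 / c) M)))
    (hδ : ∀ y ∈ closedBall x (R * t), ‖avg μ t (metricDeriv F) x - metricDeriv F y‖ ≤ δ) :
    ‖riemTensor (avgMetric μ t F) x - avg μ t (riemTensor F) x‖ ≤
      ‖principalPartCLM n‖ * ((n / c) ^ 2 * (2 * n * M * R) * t) *
          avg μ t (fun y => ‖metricHess F y‖) x +
        L * max ((n / c) ^ 2 * (2 * n * M * R) * t) δ := by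
  rw [riemTensor_avgMetric_sub hμ ht hF hc0 hc]
  exact norm_add_le_of_le (norm_principalPart_avg_sub_le hμ ht hF hc0 hc hM0 hM)
    (norm_lowerOrderPart_avg_sub_le hμ ht hF hc0 hc hM0 hM hL hδ)

end AverageMetric

section CurvatureOfAverage

variable {n : ℕ} {R t T p c K : ℝ} {F : Eucl n → Matrix (Fin n) (Fin n) ℝ} {U : Set (Eucl n)}
  {μ : Measure (Eucl n)} {x y : Eucl n}

/-- Uniform ellipticity of `G` on `U` together with `Lᵖ` bounds for its first and second
derivatives. -/
structure HasSobolevBoundsOn (p c K : ℝ) (G : Eucl n → Matrix (Fin n) (Fin n) ℝ)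
    (U : Set (Eucl n)) : Prop where
  isCoerciveWith : ∀ x ∈ U, IsCoerciveWith c (G x)
  eLpNorm_metricDeriv_le :
    eLpNorm (metricDeriv G) (ENNReal.ofReal p) (volume.restrict U) ≤ ENNReal.ofReal K
  eLpNorm_metricHess_le :
    eLpNorm (metricHess G) (ENNReal.ofReal p) (volume.restrict U) ≤ ENNReal.ofReal K

lemma eLpNorm_fderiv_metricDeriv_le {q : ℝ≥0∞} {ν : Measure (Eucl n)}
    (hF : ∀ a b, ContDiff ℝ 2 fun y => F y a b)
    (hK : eLpNorm (metricHess F) q ν ≤ ENNReal.ofReal K) :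
    eLpNorm (fderiv ℝ (metricDeriv F)) q ν ≤ ENNReal.ofReal (n * K) := by
  have hD : Differentiable ℝ (metricDeriv F) :=
    (contDiff_metricDeriv (m := 1) (by simpa [one_add_one_eq_two])).differentiable one_ne_zero
  have hle (y : Eucl n) : ‖fderiv ℝ (metricDeriv F) y‖ ≤ n * ‖metricHess F y‖ := by
    refine norm_le_of_norm_apply_stdVec_le (norm_nonneg _) fun m => ?_
    have hm : fderiv ℝ (metricDeriv F) y (stdVec m) = metricHess F y m := by
      ext l a b
      have h := hasFDerivAt_pi'.1 (hasFDerivAt_pi'.1 (hasFDerivAt_pi'.1 (hD y).hasFDerivAt l) a) b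
      rw [metricHess, partialDeriv, h.fderiv]
      rfl
    exact hm ▸ norm_le_pi_norm _ m
  calc eLpNorm (fderiv ℝ (metricDeriv F)) q ν ≤ ENNReal.ofReal n * eLpNorm (metricHess F) q ν :=
        eLpNorm_le_mul_eLpNorm_of_ae_le_mul (.of_forall hle) q
    _ ≤ ENNReal.ofReal (n * K) := by
        rw [ENNReal.ofReal_mul n.cast_nonneg]
        gcongr

section Estimates

variable [IsProbabilityMeasure μ]

lemma HasSobolevBoundsOn.norm_metricDeriv_le (hU : HasSobolevBoundsOn p c K F U)
    (hF : ∀ a b, ContDiff ℝ 2 fun y => F y a b) (hUm : MeasurableSet U) (hK : 0 ≤ K)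
    (hμν : μ ≤ volume) (hμ : ∀ᵐ z ∂μ, ‖z‖ ≤ R) (hp : 1 ≤ p) (hnp : n < p) (hT : 0 < T)
    (hy : closedBall y (R * T) ⊆ U) :
    ‖metricDeriv F y‖ ≤ T ^ (-(n / p)) * K + R * (n * K) / (1 - n / p) * T ^ (1 - n / p) := by
  simpa only [finrank_euclideanSpace_fin] using
    norm_le_of_eLpNorm_le_of_eLpNorm_fderiv_le hK (by positivity) hμν hμ hp
      (by rwa [finrank_euclideanSpace_fin]) hT hUm hy
      (contDiff_metricDeriv (by simpa [one_add_one_eq_two])) hU.eLpNorm_metricDeriv_le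
      (eLpNorm_fderiv_metricDeriv_le hF hU.eLpNorm_metricHess_le)

lemma HasSobolevBoundsOn.norm_avg_metricDeriv_sub_le (hU : HasSobolevBoundsOn p c K F U)
    (hF : ∀ a b, ContDiff ℝ 2 fun y => F y a b) (hUm : MeasurableSet U) (hK : 0 ≤ K)
    (hμν : μ ≤ volume) (hμ : ∀ᵐ z ∂μ, ‖z‖ ≤ R) (hp : 1 ≤ p) (hnp : n < p) (ht : 0 < t)
    (hx : ∀ z ∈ closedBall x (R * t), closedBall z (R * t) ⊆ U) (hy : y ∈ closedBall x (R * t)) :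
    ‖avg μ t (metricDeriv F) x - metricDeriv F y‖ ≤
      (R * (n * K) + R * (n * K) / (1 - n / p)) * t ^ (1 - n / p) := by
  simpa only [finrank_euclideanSpace_fin] using
    norm_avg_sub_le_of_mem_closedBall (by positivity) hμν hμ hp
      (by rwa [finrank_euclideanSpace_fin]) ht hUm hx
      (contDiff_metricDeriv (by simpa [one_add_one_eq_two]))
      (eLpNorm_fderiv_metricDeriv_le hF hU.eLpNorm_metricHess_le) hy

lemma HasSobolevBoundsOn.avg_norm_metricHess_le (hU : HasSobolevBoundsOn p c K F U)
    (hF : ∀ a b, ContDiff ℝ 2 fun y => F y a b) (hUm : MeasurableSet U) (hK : 0 ≤ K)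
    (hμν : μ ≤ volume) (hμ : ∀ᵐ z ∂μ, ‖z‖ ≤ R) (hp : 1 ≤ p) (ht : 0 < t)
    (hx : closedBall x (R * t) ⊆ U) :
    avg μ t (fun y => ‖metricHess F y‖) x ≤ t ^ (-(n / p)) * K := by
  simpa only [finrank_euclideanSpace_fin] using
    avg_norm_le_of_eLpNorm_le hK hμν hμ hp ht hUm hx (continuous_metricHess hF)
      hU.eLpNorm_metricHess_le

end Estimates

lemma mul_rpow_neg_add_mul_max_le (A K : ℝ) {L a b α t : ℝ} (hL : 0 ≤ L) (ha : 0 ≤ a)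
    (hb : 0 ≤ b) (hα : 0 ≤ α) (ht : 0 < t) (ht1 : t ≤ 1) :
    A * (a * t) * (t ^ (-α) * K) + L * max (a * t) (b * t ^ (1 - α)) ≤
      (A * a * K + L * (a + b)) * t ^ (1 - α) := by
  have ht_le : t ≤ t ^ (1 - α) := by
    simpa using Real.rpow_le_rpow_of_exponent_ge ht ht1 (sub_le_self 1 hα)
  have ht_mul : t * t ^ (-α) = t ^ (1 - α) := by
    rw [sub_eq_add_neg, Real.rpow_add ht, Real.rpow_one]
  have hmax : max (a * t) (b * t ^ (1 - α)) ≤ a * t ^ (1 - α) + b * t ^ (1 - α) :=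
    (max_le_add_of_nonneg (by positivity) (by positivity)).trans (by gcongr)
  calc _ ≤ A * (a * t) * (t ^ (-α) * K) + L * (a * t ^ (1 - α) + b * t ^ (1 - α)) := by gcongr
    _ = _ := by rw [← ht_mul]; ring

theorem exists_norm_riemTensor_avgMetric_sub_le (R : ℝ) (hnp : n < p) (hc : 0 < c)
    (hK : 0 ≤ K) (hT : 0 < T) (hT1 : T ≤ 1) :
    ∃ C, ∀ (μ : Measure (Eucl n)) [IsProbabilityMeasure μ], μ ≤ volume → (∀ᵐ z ∂μ, ‖z‖ ≤ R) →
      ∀ (F : Eucl n → Matrix (Fin n) (Fin n) ℝ) (U : Set (Eucl n)),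
        (∀ a b, ContDiff ℝ 2 fun y => F y a b) → MeasurableSet U →
        HasSobolevBoundsOn p c K F U → ∀ t, 0 < t → t ≤ T →
        ∀ x, closedBall x (2 * R * T) ⊆ U →
          ‖riemTensor (avgMetric μ t F) x - avg μ t (riemTensor F) x‖ ≤ C * t ^ (1 - n / p) := by
  rcases n.eq_zero_or_pos with rfl | hn
  · exact ⟨0, fun μ _ _ _ F U _ _ _ t _ _ x _ => by
      rw [norm_of_subsingleton, zero_mul]⟩
  have hp : 1 ≤ p := (Nat.one_le_cast.2 hn).trans hnp.le
  set M := T ^ (-(n / p)) * K + R * (n * K) / (1 - n / p) * T ^ (1 - n / p)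
  obtain ⟨L, hL⟩ := exists_lipschitzOnWith_lowerOrderPart n (max (1 / c) M)
  set cJ := (n / c) ^ 2 * (2 * n * M * R)
  set cD := R * (n * K) + R * (n * K) / (1 - n / p)
  refine ⟨‖principalPartCLM n‖ * cJ * K + L * (cJ + cD), fun μ _ hμν hμ F U hF hUm hU t ht htT x
    hxU => ?_⟩
  have hR := nonneg_of_ae_norm_le hμ
  have hα : 0 < 1 - n / p := sub_pos.2 ((div_lt_one (by positivity)).2 hnp)
  have hM0 : 0 ≤ M := by positivity
  have hcJ : 0 ≤ cJ := by positivity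
  have hball (y) (hy : y ∈ closedBall x (R * t)) : closedBall y (R * T) ⊆ U :=
    (closedBall_subset_closedBall' (by linarith [hy.trans (by gcongr : R * t ≤ R * T)])).trans hxU
  have hball' (y) (hy : y ∈ closedBall x (R * t)) : closedBall y (R * t) ⊆ U :=
    (closedBall_subset_closedBall (by gcongr)).trans (hball y hy)
  calc _ ≤ ‖principalPartCLM n‖ * (cJ * t) * avg μ t (fun y => ‖metricHess F y‖) x +
        L * max (cJ * t) (cD * t ^ (1 - n / p)) :=
        norm_riemTensor_avgMetric_sub_le hμ ht.le hF hc
          (fun y hy => hU.isCoerciveWith y (hball y hy (mem_closedBall_self (by positivity)))) hM0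
          (fun y hy => hU.norm_metricDeriv_le hF hUm hK hμν hμ hp hnp hT (hball y hy)) hL
          fun y hy => hU.norm_avg_metricDeriv_sub_le hF hUm hK hμν hμ hp hnp ht hball' hy
    _ ≤ ‖principalPartCLM n‖ * (cJ * t) * (t ^ (-(n / p)) * K) +
        L * max (cJ * t) (cD * t ^ (1 - n / p)) := by
        gcongr
        exact hU.avg_norm_metricHess_le hF hUm hK hμν hμ hp ht
          (hball' x (mem_closedBall_self (by positivity)))
    _ ≤ _ := mul_rpow_neg_add_mul_max_le _ K L.2 hcJ (by positivity) (by positivity) ht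
        (htT.trans hT1)

end CurvatureOfAverage

section Cubes

variable {n : ℕ} {t : ℝ} {x : Eucl n}

lemma norm_le_sqrt_mul_of_forall_abs_le (ht : 0 ≤ t) (hx : ∀ i, |x i| ≤ t) : ‖x‖ ≤ √n * t := by
  rw [EuclideanSpace.norm_eq, ← Real.sqrt_sq ht, ← Real.sqrt_mul n.cast_nonneg]
  refine Real.sqrt_le_sqrt ?_
  simpa using Finset.sum_le_card_nsmul Finset.univ (fun i => ‖x i‖ ^ 2) (t ^ 2)
    fun i _ => pow_le_pow_left₀ (norm_nonneg _) (hx i) 2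

lemma openCube_subset_closedBall (ht : 0 ≤ t) : openCube x t ⊆ closedBall x (√n * t) := fun y hy =>
  (dist_eq_norm y x).trans_le (norm_le_sqrt_mul_of_forall_abs_le ht fun i => (hy i).le)

lemma ball_subset_openCube : ball x t ⊆ openCube x t := fun y hy i =>
  (PiLp.norm_apply_le (y - x) i).trans_lt (by rwa [← dist_eq_norm])

lemma sub_smul_mem_openCube {z : Eucl n} (ht : 0 < t) (hz : ∀ i, |z i| < 1) :
    x - t • z ∈ openCube x t := fun i => by
  simpa [abs_mul, abs_of_pos ht] using mul_lt_mul_of_pos_left (hz i) ht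

lemma sub_smul_mem_ball {z : Eucl n} (ht : 0 < t) (hz : ‖z‖ < 1) : x - t • z ∈ ball x t := by
  simpa [dist_eq_norm, norm_smul, abs_of_pos ht] using mul_lt_mul_of_pos_left hz ht

end Cubes

section Kernel

variable {n : ℕ} {φ : Eucl n → ℝ} {r s t c : ℝ} {F G : Eucl n → Matrix (Fin n) (Fin n) ℝ}
  {x : Eucl n}

/-- The measure with density `φ`, with respect to which mollification is an average. -/
noncomputable def kernelMeasure (φ : Eucl n → ℝ) : Measure (Eucl n) :=
  volume.withDensity fun z => ENNReal.ofReal (φ z)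

namespace IsMollificationKernel

lemma hasCompactSupport (hφ : IsMollificationKernel φ) : HasCompactSupport φ :=
  .of_support_subset_isCompact (isCompact_closedBall 0 (√n * 1)) fun _ hz =>
    mem_closedBall_zero_iff.2 <|
      norm_le_sqrt_mul_of_forall_abs_le zero_le_one (hφ.support_subset hz)

lemma isProbabilityMeasure (hφ : IsMollificationKernel φ) :
    IsProbabilityMeasure (kernelMeasure φ) where
  measure_univ := by
    rw [kernelMeasure, withDensity_apply _ .univ, Measure.restrict_univ,
      ← ofReal_integral_eq_lintegral_ofReal
        (hφ.contDiff.continuous.integrable_of_hasCompactSupport hφ.hasCompactSupport)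
        (.of_forall hφ.nonneg), hφ.integral_eq_one, ENNReal.ofReal_one]

lemma kernelMeasure_le (hφ : IsMollificationKernel φ) : kernelMeasure φ ≤ volume := by
  conv_rhs => rw [← withDensity_one (μ := (volume : Measure (Eucl n)))]
  exact withDensity_mono (.of_forall fun z => by simpa using hφ.le_one z)

lemma ae_mem_interior (hφ : IsMollificationKernel φ) {S : Set (Eucl n)}
    (hS : Function.support φ ⊆ S) : ∀ᵐ z ∂kernelMeasure φ, z ∈ interior S := by
  rw [kernelMeasure, ae_withDensity_iff hφ.contDiff.continuous.measurable.ennreal_ofReal]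
  refine .of_forall fun z hz => interior_maximal hS hφ.contDiff.continuous.isOpen_support fun h0 =>
    hz ?_
  rw [h0, ENNReal.ofReal_zero]

lemma ae_abs_apply_lt (hφ : IsMollificationKernel φ) :
    ∀ᵐ z ∂kernelMeasure φ, ∀ i, |z i| < 1 := by
  refine ae_all_iff.2 fun i => ?_
  have hopen : IsOpenMap (EuclideanSpace.proj i : Eucl n →L[ℝ] ℝ) :=
    ContinuousLinearMap.isOpenMap _ fun a => ⟨EuclideanSpace.single i a, by simp⟩
  have hsupp : Function.support φ ⊆
      (EuclideanSpace.proj i : Eucl n →L[ℝ] ℝ) ⁻¹' closedBall (0 : ℝ) 1 := fun z hz => by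
    simpa using hφ.support_subset hz i
  filter_upwards [hφ.ae_mem_interior hsupp] with z hz
  rw [← hopen.preimage_interior_eq_interior_preimage (ContinuousLinearMap.continuous _),
    interior_closedBall _ one_ne_zero] at hz
  simpa using hz

lemma ae_norm_le (hφ : IsMollificationKernel φ) : ∀ᵐ z ∂kernelMeasure φ, ‖z‖ ≤ √n := by
  filter_upwards [hφ.ae_abs_apply_lt] with z hz
  simpa using norm_le_sqrt_mul_of_forall_abs_le zero_le_one fun i => (hz i).le

lemma ae_norm_lt (hφ : IsMollificationKernel φ)
    (hsupp : Function.support φ ⊆ closedBall (0 : Eucl n) 1) :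
    ∀ᵐ z ∂kernelMeasure φ, ‖z‖ < 1 := by
  filter_upwards [hφ.ae_mem_interior hsupp] with z hz
  rw [interior_closedBall _ one_ne_zero] at hz
  simpa using hz

lemma mollify_eq_avg (hφ : IsMollificationKernel φ) (ht : 0 < t) (f : Eucl n → ℝ) :
    mollify φ t f = avg (kernelMeasure φ) t f := by
  ext x
  rw [avg, kernelMeasure, integral_withDensity_eq_integral_toReal_smul
    hφ.contDiff.continuous.measurable.ennreal_ofReal (by simp)]
  calc mollify φ t f x = ∫ y, (t ^ n)⁻¹ * (φ (t⁻¹ • y) * f (x - y)) := by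
        simp only [mollify, convolution, scaledKernel, ContinuousLinearMap.lsmul_apply, smul_eq_mul,
          mul_assoc]
    _ = ∫ z, φ (t⁻¹ • t • z) * f (x - t • z) := by
        rw [Measure.integral_comp_smul volume (fun y => φ (t⁻¹ • y) * f (x - y)) t,
          finrank_euclideanSpace_fin, abs_of_pos (by positivity), smul_eq_mul, integral_const_mul]
    _ = _ := by simp only [inv_smul_smul₀ ht.ne', ENNReal.toReal_ofReal (hφ.nonneg _), smul_eq_mul]

lemma contDiff_mollify (hφ : IsMollificationKernel φ) (ht : 0 < t) {f : Eucl n → ℝ}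
    (hf : LocallyIntegrable f) : ContDiff ℝ ∞ (mollify φ t f) := by
  refine HasCompactSupport.contDiff_convolution_left _ ?_ ?_ hf
  · exact (hφ.hasCompactSupport.comp_smul (inv_ne_zero ht.ne')).mul_left
  · exact contDiff_const.mul (hφ.contDiff.comp (contDiff_const_smul _))

lemma mollifyMetric_eq_avgMetric (hφ : IsMollificationKernel φ) (ht : 0 < t)
    (hx : closedBall x (√n * t) ⊆ ball 0 r) (hFG : EqOn F G (closedBall x (√n * t))) :
    mollifyMetric φ r t G x = avgMetric (kernelMeasure φ) t F x := by
  ext a b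
  rw [mollifyMetric, avgMetric, Matrix.of_apply, Matrix.of_apply, hφ.mollify_eq_avg ht]
  refine avg_congr hφ.ae_norm_le ht.le fun y hy => ?_
  rw [indicator_of_mem (hx hy), hFG hy]

end IsMollificationKernel

lemma closedBall_subset_ball_zero {E : Type*} [SeminormedAddCommGroup E] {x : E} {s t r : ℝ}
    (hx : x ∈ ball 0 s) (hst : s + t ≤ r) : closedBall x t ⊆ ball 0 r :=
  (closedBall_subset_ball' (by rw [mem_ball] at hx; linarith))

lemma exists_contDiff_eqOn_closedBall {E V : Type*} [NormedAddCommGroup E] [NormedSpace ℝ E]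
    [HasContDiffBump E] [NormedAddCommGroup V] [NormedSpace ℝ V] {m : ℕ∞} {c : E} {r s : ℝ}
    {f : E → V} (hs : 0 < s) (hsr : s < r) (hf : ContDiffOn ℝ m f (ball c r)) :
    ∃ F, ContDiff ℝ m F ∧ EqOn F f (closedBall c s) := by
  let χ : ContDiffBump c := ⟨s, (s + r) / 2, hs, by linarith⟩
  refine ⟨fun y => χ y • f y, contDiff_iff_contDiffAt.2 fun y => ?_, fun y hy => ?_⟩
  · by_cases hy : y ∈ ball c r
    · exact χ.contDiffAt.smul (hf.contDiffAt (isOpen_ball.mem_nhds hy))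
    · have hzero : χ =ᶠ[𝓝 y] 0 := by
        rw [← notMem_tsupport_iff_eventuallyEq, χ.tsupport_eq]
        exact fun h => hy (closedBall_subset_ball (show (s + r) / 2 < r by linarith) h)
      exact (contDiffAt_const (c := 0)).congr_of_eventuallyEq
        (hzero.mono fun z hz => by simp [hz])
  · simp only [χ.one_of_mem_closedBall hy, one_smul]

lemma exists_contDiff_metric_eqOn_closedBall {m : ℕ∞} (hs : 0 < s) (hsr : s < r)
    (hG : ∀ a b, ContDiffOn ℝ m (fun y => G y a b) (ball 0 r)) :
    ∃ F : Eucl n → Matrix (Fin n) (Fin n) ℝ, (∀ a b, ContDiff ℝ m fun y => F y a b) ∧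
      EqOn F G (closedBall 0 s) := by
  choose F hF hFG using fun a b => exists_contDiff_eqOn_closedBall hs hsr (hG a b)
  exact ⟨fun y => Matrix.of fun a b => F a b y, hF, fun y hy => by ext a b; exact hFG a b hy⟩

lemma IsMollificationKernel.contDiffOn_mollifyMetric (hφ : IsMollificationKernel φ) (ht : 0 < t)
    (hst : s + √n * t < r) (hG : ∀ a b, ContinuousOn (fun y => G y a b) (ball 0 r)) (a b : Fin n) :
    ContDiffOn ℝ ∞ (fun x => mollifyMetric φ r t G x a b) (ball 0 s) := by
  rcases le_or_gt s 0 with hs | hs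
  · simp [ball_eq_empty.2 hs]
  obtain ⟨F, hF, hFG⟩ := exists_contDiff_metric_eqOn_closedBall (m := 0) (by positivity) hst
    fun a b => contDiffOn_zero.2 (hG a b)
  refine (hφ.contDiff_mollify ht (hF a b).continuous.locallyIntegrable).contDiffOn.congr
    fun x hx => ?_
  rw [hφ.mollifyMetric_eq_avgMetric ht (closedBall_subset_ball_zero hx hst.le)
    (hFG.mono ((closedBall_subset_ball_zero hx le_rfl).trans ball_subset_closedBall)),
    hφ.mollify_eq_avg ht]
  rfl

lemma IsMollificationKernel.isCoerciveWith_mollifyMetric (hφ : IsMollificationKernel φ) (ht : 0 < t)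
    (hx : closedBall x (√n * t) ⊆ ball 0 r)
    (hG : ∀ a b, ContinuousOn (fun y => G y a b) (ball 0 r))
    (hc : ∀ y ∈ ball 0 r, IsCoerciveWith c (G y)) :
    IsCoerciveWith c (mollifyMetric φ r t G x) := by
  have := hφ.isProbabilityMeasure
  rw [hφ.mollifyMetric_eq_avgMetric ht hx (eqOn_refl G _)]
  exact isCoerciveWith_avgMetric hφ.ae_norm_le ht.le (fun a b => (hG a b).mono hx)
    fun y hy => hc y (hx hy)

lemma isSymm_mollifyMetric (hG : ∀ y ∈ ball 0 r, (G y).IsSymm) :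
    (mollifyMetric φ r t G x).IsSymm := by
  ext a b
  have hab : (ball 0 r).indicator (fun y => G y b a) = (ball 0 r).indicator fun y => G y a b :=
    indicator_congr fun y hy => (hG y hy).apply a b
  rw [Matrix.transpose_apply, mollifyMetric, Matrix.of_apply, Matrix.of_apply, hab]

end Kernel

section CurvatureExcess

variable {n : ℕ} {μ : Measure (Eucl n)} {G G' : Eucl n → Matrix (Fin n) (Fin n) ℝ}
  {R p c K r s t T b b' β : ℝ} {x : Eucl n} {S U V : Set (Eucl n)} {w : Fin 4 → Fin n → ℝ}

lemma CurvatureExcessLE.mono (h : CurvatureExcessLE G' G x S w b) (hb : b ≤ b') :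
    CurvatureExcessLE G' G x S w b' :=
  ⟨h.1, h.2.trans hb⟩

lemma curvatureExcessLE_of_norm_riemTensor_sub_avg_le [IsProbabilityMeasure μ]
    (hμ : ∀ᵐ z ∂μ, ‖z‖ ≤ R) (ht : 0 ≤ t)
    (hG : ContinuousOn (riemTensor G) (closedBall x (R * t))) (hS : ∀ᵐ z ∂μ, x - t • z ∈ S)
    (hSR : S ⊆ closedBall x (R * t))
    (hb : ‖riemTensor G' x - avg μ t (riemTensor G) x‖ ≤ b) :
    CurvatureExcessLE G' G x S w (n ^ 4 * ‖w‖ ^ 4 * b) := by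
  have hcont : ContinuousOn (fun y => riem G y w) (closedBall x (R * t)) :=
    (contraction w).continuous.comp_continuousOn hG
  have hbdd : BddAbove ((fun y => riem G y w) '' S) :=
    ((isCompact_closedBall x (R * t)).bddAbove_image hcont).mono (image_mono hSR)
  have havg : avg μ t (fun y => riem G y w) x ≤ sSup ((fun y => riem G y w) '' S) := by
    simpa [avg] using integral_mono_ae (integrable_comp_sub_smul hμ ht hcont) (integrable_const _)
      (hS.mono fun z hz => le_csSup hbdd ⟨_, hz, rfl⟩)
  refine ⟨hbdd, ?_⟩
  calc riem G' x w - sSup ((fun y => riem G y w) '' S)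
      ≤ riem G' x w - avg μ t (fun y => riem G y w) x := sub_le_sub_left havg _
    _ = contraction w (riemTensor G' x - avg μ t (riemTensor G) x) := by
        simp only [map_sub, ← avg_clm_comp hμ ht hG, riem_eq_contraction]
    _ ≤ ‖contraction w (riemTensor G' x - avg μ t (riemTensor G) x)‖ := le_abs_self _
    _ ≤ n ^ 4 * ‖w‖ ^ 4 * ‖riemTensor G' x - avg μ t (riemTensor G) x‖ := norm_contraction_le w _
    _ ≤ n ^ 4 * ‖w‖ ^ 4 * b := by gcongr

lemma IsMollificationKernel.curvatureExcessLE_openCube {φ : Eucl n → ℝ}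
    (hφ : IsMollificationKernel φ) (ht : 0 < t)
    (hG : ContinuousOn (riemTensor G) (closedBall x (√n * t)))
    (hb : ‖riemTensor G' x - avg (kernelMeasure φ) t (riemTensor G) x‖ ≤ b) :
    CurvatureExcessLE G' G x (openCube x t) w (n ^ 4 * ‖w‖ ^ 4 * b) :=
  have := hφ.isProbabilityMeasure
  curvatureExcessLE_of_norm_riemTensor_sub_avg_le hφ.ae_norm_le ht.le hG
    (hφ.ae_abs_apply_lt.mono fun _ hz => sub_smul_mem_openCube ht hz)
    (openCube_subset_closedBall ht.le) hb

lemma IsMollificationKernel.curvatureExcessLE_ball {φ : Eucl n → ℝ}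
    (hφ : IsMollificationKernel φ) (hsupp : Function.support φ ⊆ closedBall 0 1) (ht : 0 < t)
    (hG : ContinuousOn (riemTensor G) (closedBall x (√n * t)))
    (hb : ‖riemTensor G' x - avg (kernelMeasure φ) t (riemTensor G) x‖ ≤ b) :
    CurvatureExcessLE G' G x (ball x t) w (n ^ 4 * ‖w‖ ^ 4 * b) :=
  have := hφ.isProbabilityMeasure
  curvatureExcessLE_of_norm_riemTensor_sub_avg_le hφ.ae_norm_le ht.le hG
    ((hφ.ae_norm_lt hsupp).mono fun _ hz => sub_smul_mem_ball ht hz)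
    (ball_subset_openCube.trans (openCube_subset_closedBall ht.le)) hb

lemma continuousOn_riemTensor_ball (hG : ∀ a b, ContDiffOn ℝ 2 (fun y => G y a b) (ball 0 r))
    (hdet : ∀ y ∈ ball 0 r, IsUnit (G y).det) : ContinuousOn (riemTensor G) (ball 0 r) := by
  refine fun x hx => ContinuousAt.continuousWithinAt ?_
  obtain ⟨s, hxs, hsr⟩ := exists_between (mem_ball.1 hx)
  obtain ⟨F, hF, hFG⟩ :=
    exists_contDiff_metric_eqOn_closedBall (m := 2) (dist_nonneg.trans_lt hxs) hsr hG
  have hFG' : EqOn F G (ball 0 s) := hFG.mono ball_subset_closedBall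
  have hFdet (y) (hy : y ∈ ball 0 s) : IsUnit (F y).det :=
    hFG' hy ▸ hdet y (ball_subset_ball hsr.le hy)
  have hriem : EqOn (riemTensor F) (riemTensor G) (ball 0 s) := fun y hy =>
    riemTensor_congr (hFG'.eventuallyEq_of_mem (isOpen_ball.mem_nhds hy))
  exact (((continuousOn_riemTensor hF hFdet).congr hriem.symm).continuousAt
    (isOpen_ball.mem_nhds hxs))

lemma HasSobolevBoundsOn.congr_of_isOpen {F : Eucl n → Matrix (Fin n) (Fin n) ℝ}
    (hU : HasSobolevBoundsOn p c K G U) (hV : IsOpen V) (hVU : V ⊆ U) (hFG : EqOn F G V) :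
    HasSobolevBoundsOn p c K F V := by
  have hFG' (y) (hy : y ∈ V) : F =ᶠ[𝓝 y] G := hFG.eventuallyEq_of_mem (hV.mem_nhds hy)
  refine ⟨fun y hy => hFG hy ▸ hU.isCoerciveWith y (hVU hy), ?_, ?_⟩
  · rw [eLpNorm_congr_ae ((ae_restrict_mem hV.measurableSet).mono fun y hy =>
      (metricDeriv_congr (hFG' y hy)).eq_of_nhds)]
    exact (eLpNorm_mono_measure _ (Measure.restrict_mono hVU le_rfl)).trans
      hU.eLpNorm_metricDeriv_le
  · rw [eLpNorm_congr_ae ((ae_restrict_mem hV.measurableSet).mono fun y hy =>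
      metricHess_congr (hFG' y hy))]
    exact (eLpNorm_mono_measure _ (Measure.restrict_mono hVU le_rfl)).trans
      hU.eLpNorm_metricHess_le

theorem exists_norm_riemTensor_mollifyMetric_sub_le (hnp : n < p) (hc : 0 < c) (hK : 0 ≤ K)
    (hT : 0 < T) (hT1 : T ≤ 1) (hsr : s + 2 * √n * T < r) :
    ∃ C, ∀ φ : Eucl n → ℝ, IsMollificationKernel φ →
      ∀ G : Eucl n → Matrix (Fin n) (Fin n) ℝ,
        (∀ a b, ContDiffOn ℝ 2 (fun y => G y a b) (ball 0 r)) →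
        HasSobolevBoundsOn p c K G (ball 0 r) → ∀ t, 0 < t → t ≤ T → ∀ x ∈ ball 0 s,
          ‖riemTensor (mollifyMetric φ r t G) x - avg (kernelMeasure φ) t (riemTensor G) x‖ ≤
            C * t ^ (1 - n / p) := by
  obtain ⟨C, hC⟩ := exists_norm_riemTensor_avgMetric_sub_le (√n) hnp hc hK hT hT1
  refine ⟨C, fun φ hφ G hG hGr t ht htT x hx => ?_⟩
  have hs : 0 < s := pos_of_mem_ball hx
  have := hφ.isProbabilityMeasure
  obtain ⟨F, hF, hFG⟩ :=
    exists_contDiff_metric_eqOn_closedBall (m := 2) (by positivity) hsr hG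
  have hFG' : EqOn F G (ball 0 (s + 2 * √n * T)) := hFG.mono ball_subset_closedBall
  have hball (y : Eucl n) (hy : y ∈ ball 0 s) : closedBall y (√n * t) ⊆ ball 0 (s + 2 * √n * T) :=
    closedBall_subset_ball_zero hy <| by
      have hnt : √n * t ≤ √n * T := by gcongr
      linarith [mul_nonneg (Real.sqrt_nonneg n) hT.le]
  have hmoll : mollifyMetric φ r t G =ᶠ[𝓝 x] avgMetric (kernelMeasure φ) t F := by
    filter_upwards [isOpen_ball.mem_nhds hx] with y hy
    exact hφ.mollifyMetric_eq_avgMetric ht ((hball y hy).trans (ball_subset_ball hsr.le))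
      (hFG'.mono (hball y hy))
  have hriem : EqOn (riemTensor G) (riemTensor F) (ball 0 (s + 2 * √n * T)) := fun y hy =>
    riemTensor_congr (hFG'.symm.eventuallyEq_of_mem (isOpen_ball.mem_nhds hy))
  rw [riemTensor_congr hmoll, avg_congr hφ.ae_norm_le ht.le (hriem.mono (hball x hx))]
  exact hC _ hφ.kernelMeasure_le hφ.ae_norm_le F _ hF measurableSet_ball
    (hGr.congr_of_isOpen isOpen_ball (ball_subset_ball hsr.le) hFG') t ht htT x
    (closedBall_subset_ball_zero hx le_rfl)

theorem exists_curvatureExcessLE_mollifyMetric (hnp : n < p) (hc : 0 < c) (hK : 0 ≤ K)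
    (hT : 0 < T) (hT1 : T ≤ 1) (hsr : s + 2 * √n * T < r) (hβ : β ≤ 1 - n / p) :
    ∃ C, 0 < C ∧ ∀ φ : Eucl n → ℝ, IsMollificationKernel φ →
      ∀ G : Eucl n → Matrix (Fin n) (Fin n) ℝ,
        (∀ a b, ContDiffOn ℝ 2 (fun y => G y a b) (ball 0 r)) →
        HasSobolevBoundsOn p c K G (ball 0 r) → ∀ t, 0 < t → t ≤ T → ∀ x ∈ ball 0 s, ∀ w b,
          ‖w‖ ≤ b →
          CurvatureExcessLE (mollifyMetric φ r t G) G x (openCube x t) w (C * b ^ 4 * t ^ β) ∧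
          (Function.support φ ⊆ closedBall 0 1 →
            CurvatureExcessLE (mollifyMetric φ r t G) G x (ball x t) w (C * b ^ 4 * t ^ β)) := by
  obtain ⟨C, hC⟩ := exists_norm_riemTensor_mollifyMetric_sub_le hnp hc hK hT hT1 hsr
  refine ⟨n ^ 4 * |C| + 1, by positivity, fun φ hφ G hG hGr t ht htT x hx w b hw => ?_⟩
  have hb : n ^ 4 * ‖w‖ ^ 4 * (C * t ^ (1 - n / p)) ≤ (n ^ 4 * |C| + 1) * b ^ 4 * t ^ β := calc
    _ ≤ n ^ 4 * ‖w‖ ^ 4 * (|C| * t ^ β) := by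
      gcongr ?_ * ?_
      exact mul_le_mul (le_abs_self C)
        (Real.rpow_le_rpow_of_exponent_ge ht (htT.trans hT1) hβ) (by positivity) (abs_nonneg C)
    _ = n ^ 4 * |C| * ‖w‖ ^ 4 * t ^ β := by ring
    _ ≤ _ := by gcongr; exact le_add_of_nonneg_right zero_le_one
  have hsub : closedBall x (√n * t) ⊆ ball 0 r := closedBall_subset_ball_zero hx <| by
    have hnt : √n * t ≤ √n * T := by gcongr
    linarith [mul_nonneg (Real.sqrt_nonneg n) hT.le]
  have hriem := (continuousOn_riemTensor_ball hG fun y hy =>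
    (hGr.isCoerciveWith y hy).isUnit_det hc).mono hsub
  have hnorm := hC φ hφ G hG hGr t ht htT x hx
  exact ⟨(hφ.curvatureExcessLE_openCube ht hriem hnorm).mono hb,
    fun hsupp => (hφ.curvatureExcessLE_ball hsupp ht hriem hnorm).mono hb⟩

end CurvatureExcess

section Charts

lemma contMDiffOn_mfderiv_apply {E E' H M : Type*} [NormedAddCommGroup E] [NormedSpace ℝ E]
    [NormedAddCommGroup E'] [NormedSpace ℝ E'] [TopologicalSpace H] {I : ModelWithCorners ℝ E' H}
    [TopologicalSpace M] [ChartedSpace H M] [IsManifold I ∞ M] {ψ : E → M} {s : Set E}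
    (hs : IsOpen s) (hψ : ContMDiffOn 𝓘(ℝ, E) I ∞ ψ s) (v : E) :
    ContMDiffOn 𝓘(ℝ, E) I.tangent ∞
      (fun x => (⟨ψ x, mfderiv 𝓘(ℝ, E) I ψ x v⟩ : TangentBundle I M)) s := by
  have hconst : ContMDiff 𝓘(ℝ, E) 𝓘(ℝ, E).tangent ∞
      fun x => (⟨x, v⟩ : TangentBundle 𝓘(ℝ, E) E) :=
    contMDiff_vectorSpace_iff_contDiff.2 contDiff_const
  refine ((hψ.contMDiffOn_tangentMapWithin (m := ∞) (by simp) hs.uniqueMDiffOn).comp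
    (hconst.contMDiffOn (s := s)) fun x hx => hx).congr fun x hx => ?_
  rw [Function.comp_apply, tangentMapWithin, mfderivWithin_of_isOpen hs hx]

variable {n : ℕ} {M : Type*} [TopologicalSpace M] [ChartedSpace (Eucl n) M]

lemma IsPointedChart.contMDiffOn {r : ℝ} {x₀ : M} {ψ : OpenPartialHomeomorph (Eucl n) M}
    (hψ : IsPointedChart r x₀ ψ) :
    ContMDiffOn 𝓘(ℝ, Eucl n) 𝓘(ℝ, Eucl n) ∞ ψ (ball 0 r) := by
  simpa [hψ.source_eq] using contMDiffOn_symm_of_mem_maximalAtlas hψ.mem_atlas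

variable [IsManifold 𝓘(ℝ, Eucl n) ∞ M]

lemma contDiffOn_pullbackMetric (g : SmoothMetric n M) {ψ : Eucl n → M} {s : Set (Eucl n)}
    (hs : IsOpen s) (hψ : ContMDiffOn 𝓘(ℝ, Eucl n) 𝓘(ℝ, Eucl n) ∞ ψ s) (i j : Fin n) :
    ContDiffOn ℝ ∞ (fun x => pullbackMetric g ψ x i j) s := by
  have hdψ := contMDiffOn_mfderiv_apply hs hψ
  rw [← contMDiffOn_iff_contDiffOn]
  intro x hx
  have hinner := ContMDiffWithinAt.clm_bundle_apply₂ (F₁ := Eucl n) (F₂ := Eucl n) (F₃ := ℝ)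
    (E₃ := fun _ : M => ℝ) ((g.contMDiff (ψ x)).comp_contMDiffWithinAt x (hψ x hx))
    (hdψ (stdVec i) x hx) (hdψ (stdVec j) x hx)
  exact (Bundle.contMDiffWithinAt_totalSpace.1 hinner).2

lemma isSymm_pullbackMetric (g : SmoothMetric n M) (ψ : Eucl n → M) (x : Eucl n) :
    (pullbackMetric g ψ x).IsSymm :=
  .ext fun _ _ => g.symm _ _ _

end Charts

section ChartNorm

variable {n : ℕ} {p r Q : ℝ} {G : Eucl n → Matrix (Fin n) (Fin n) ℝ} {x : Eucl n}

lemma norm_metricDeriv_le_norm_nablaPow (G : Eucl n → Matrix (Fin n) (Fin n) ℝ) (x : Eucl n) :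
    ‖metricDeriv G x‖ ≤ ‖nablaPow 1 G x‖ := by
  refine (pi_norm_le_iff_of_nonneg (norm_nonneg _)).2 fun l =>
    (pi_norm_le_iff_of_nonneg (norm_nonneg _)).2 fun a =>
    (pi_norm_le_iff_of_nonneg (norm_nonneg _)).2 fun b => ?_
  have hl : metricDeriv G x l a b = nablaPow 1 G x a b ![l] := by
    rw [nablaPow, iteratedFDeriv_one_apply]
    rfl
  rw [hl]
  exact (norm_le_pi_norm (nablaPow 1 G x a b) _).trans <|
    (norm_le_pi_norm (nablaPow 1 G x a) b).trans (norm_le_pi_norm _ a)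

lemma norm_metricHess_le_norm_nablaPow (hG : ∀ a b, ContDiffAt ℝ 2 (fun y => G y a b) x) :
    ‖metricHess G x‖ ≤ ‖nablaPow 2 G x‖ := by
  refine (pi_norm_le_iff_of_nonneg (norm_nonneg _)).2 fun m =>
    (pi_norm_le_iff_of_nonneg (norm_nonneg _)).2 fun l =>
    (pi_norm_le_iff_of_nonneg (norm_nonneg _)).2 fun a =>
    (pi_norm_le_iff_of_nonneg (norm_nonneg _)).2 fun b => ?_
  have hml : metricHess G x m l a b = nablaPow 2 G x a b ![m, l] := by
    have hdiff : DifferentiableAt ℝ (fderiv ℝ fun y => G y a b) x :=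
      ((hG a b).fderiv_right (m := 1) (by simp [one_add_one_eq_two])).differentiableAt one_ne_zero
    have h := hdiff.hasFDerivAt.clm_apply (hasFDerivAt_const (stdVec l : Eucl n) x)
    rw [nablaPow, iteratedFDeriv_two_apply, metricHess, partialDeriv]
    simp only [metricDeriv, partialDeriv]
    rw [h.fderiv]
    simp
  rw [hml]
  exact (norm_le_pi_norm (nablaPow 2 G x a b) _).trans <|
    (norm_le_pi_norm (nablaPow 2 G x a) b).trans (norm_le_pi_norm _ a)

lemma SobolevChartNormLE.eLpNorm_nablaPow_le {k m : ℕ} (hr : 0 < r)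
    (hG : SobolevChartNormLE m p r Q G) (hk : k ≤ m) :
    eLpNorm (nablaPow k G) (ENNReal.ofReal p) (volume.restrict (ball 0 r)) ≤
      ENNReal.ofReal (r ^ (n / p - k) * Q) := by
  have hcancel : ENNReal.ofReal (r ^ (n / p - k)) * ENNReal.ofReal (r ^ (k - n / p)) = 1 := by
    rw [← ENNReal.ofReal_mul (by positivity), ← Real.rpow_add hr, sub_add_sub_cancel, sub_self,
      Real.rpow_zero, ENNReal.ofReal_one]
  rw [ENNReal.ofReal_mul (by positivity), ← one_mul (eLpNorm _ _ _), ← hcancel, mul_assoc]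
  gcongr
  exact hG.sobolev k hk

lemma SobolevChartNormLE.hasSobolevBoundsOn (hr : 0 < r) (hQ : 0 ≤ Q)
    (hG : ∀ a b, ContDiffOn ℝ 2 (fun y => G y a b) (ball 0 r))
    (hGQ : SobolevChartNormLE 2 p r Q G) :
    HasSobolevBoundsOn p (Real.exp (-2 * Q)) ((r ^ (n / p - 1) + r ^ (n / p - 2)) * Q) G
      (ball 0 r) where
  isCoerciveWith y hy v := (hGQ.lower y hy v).trans_eq (sum_sum_mul_mul_eq_dotProduct_mulVec ..)
  eLpNorm_metricDeriv_le := calc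
    _ ≤ eLpNorm (nablaPow 1 G) (ENNReal.ofReal p) (volume.restrict (ball 0 r)) :=
      eLpNorm_mono (norm_metricDeriv_le_norm_nablaPow G)
    _ ≤ ENNReal.ofReal (r ^ (n / p - 1) * Q) := by
      exact_mod_cast hGQ.eLpNorm_nablaPow_le hr one_le_two
    _ ≤ _ := by
      gcongr
      exact le_add_of_nonneg_right (by positivity)
  eLpNorm_metricHess_le := calc
    _ ≤ eLpNorm (nablaPow 2 G) (ENNReal.ofReal p) (volume.restrict (ball 0 r)) :=
      eLpNorm_mono_ae <| (ae_restrict_mem measurableSet_ball).mono fun y hy =>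
        norm_metricHess_le_norm_nablaPow fun a b =>
          (hG a b).contDiffAt (isOpen_ball.mem_nhds hy)
    _ ≤ ENNReal.ofReal (r ^ (n / p - 2) * Q) := by
      exact_mod_cast hGQ.eLpNorm_nablaPow_le hr le_rfl
    _ ≤ _ := by
      gcongr
      exact le_add_of_nonneg_left (by positivity)

lemma norm_le_toReal_eLpNorm_top {X E : Type*} [TopologicalSpace X] [MeasurableSpace X]
    [NormedAddCommGroup E] {μ : Measure X} [μ.IsOpenPosMeasure] {U : Set X} {v : X → E} {x : X}
    (hU : IsOpen U) (hv : ContinuousOn v U) (hv' : MemLp v ∞ (μ.restrict U)) (hx : x ∈ U) :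
    ‖v x‖ ≤ (eLpNorm v ∞ (μ.restrict U)).toReal := by
  set V := (eLpNorm v ∞ (μ.restrict U)).toReal
  have hle : (fun y => max ‖v y‖ V) =ᵐ[μ.restrict U] fun _ => V := by
    filter_upwards [ae_le_eLpNormEssSup (f := v) (μ := μ.restrict U)] with y hy
    rw [max_eq_right]
    rwa [← ENNReal.ofReal_le_iff_le_toReal hv'.2.ne, ofReal_norm, eLpNorm_exponent_top]
  exact max_eq_right_iff.1 <|
    Measure.eqOn_open_of_ae_eq hle hU (hv.norm.sup continuousOn_const) continuousOn_const hx

end ChartNorm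

end MollifiedCurvature

open MollifiedCurvature in
theorem mainTheorem3_general (n : ℕ) (p r Q β : ℝ) (hp : n < p) (hr : 0 < r) (hQ : 0 ≤ Q)
    (hβ : β ≤ 1 - n / p) :
    ∃ T : ℝ, 0 < T ∧ T < r / 2 ∧ ∃ C : ℝ, 0 < C ∧
      ∀ φ : Eucl n → ℝ, IsMollificationKernel φ →
      ∀ G : Eucl n → Matrix (Fin n) (Fin n) ℝ, (∀ x ∈ ball (0 : Eucl n) r, (G x).IsSymm) →
      (∀ a b, ContDiffOn ℝ 2 (fun x => G x a b) (ball (0 : Eucl n) r)) →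
      SobolevChartNormLE 2 p r Q G →
      ∀ t : ℝ, 0 < t → t ≤ T →
        (∀ a b, ContDiffOn ℝ ∞ (fun x => mollifyMetric φ r t G x a b)
          (ball (0 : Eucl n) (r / 2))) ∧
        (∀ x ∈ ball (0 : Eucl n) (r / 2), (mollifyMetric φ r t G x).PosDef) ∧
        ∀ v : Eucl n → Fin 4 → Fin n → ℝ, ContinuousOn v (ball (0 : Eucl n) r) →
          MemLp v ∞ (volume.restrict (ball (0 : Eucl n) r)) →
          ∀ x ∈ ball (0 : Eucl n) (r / 2),
            CurvatureExcessLE (mollifyMetric φ r t G) G x (openCube x t) (v x)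
              (C * (eLpNorm v ∞ (volume.restrict (ball (0 : Eucl n) r))).toReal ^ 4 * t ^ β) ∧
            (Function.support φ ⊆ closedBall (0 : Eucl n) 1 →
              CurvatureExcessLE (mollifyMetric φ r t G) G x (ball x t) (v x)
                (C * (eLpNorm v ∞ (volume.restrict (ball (0 : Eucl n) r))).toReal ^ 4
                  * t ^ β)) := by
  obtain ⟨T₀, hT₀, hT₀r⟩ := exists_pos_mul_lt (half_pos hr) (1 + 2 * √n)
  set T := min T₀ 1
  have hT : 0 < T := by positivity
  have hTr : (1 + 2 * √n) * T < r / 2 := hT₀r.trans_le' (by gcongr; exact min_le_left _ _)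
  obtain ⟨C, hC, hexcess⟩ := exists_curvatureExcessLE_mollifyMetric (s := r / 2) hp
    (Real.exp_pos (-2 * Q)) (by positivity : 0 ≤ (r ^ (n / p - 1) + r ^ (n / p - 2)) * Q) hT
    (min_le_right _ _) (by linarith : r / 2 + 2 * √n * T < r) hβ
  have hnT : 0 ≤ √n * T := by positivity
  refine ⟨T, hT, by linarith, C, hC, fun φ hφ G hsymm hG hGQ t ht htT => ?_⟩
  have hGr := hGQ.hasSobolevBoundsOn hr hQ hG
  have hnt : r / 2 + √n * t < r := by linarith [mul_le_mul_of_nonneg_left htT (Real.sqrt_nonneg n)]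
  have hcont (a b) : ContinuousOn (fun y => G y a b) (ball 0 r) := (hG a b).continuousOn
  exact ⟨hφ.contDiffOn_mollifyMetric ht hnt hcont, fun x hx =>
    (hφ.isCoerciveWith_mollifyMetric ht (closedBall_subset_ball_zero hx hnt.le) hcont
      hGr.isCoerciveWith).posDef (Real.exp_pos _) (isSymm_mollifyMetric hsymm),
    fun v hv hv' x hx => hexcess φ hφ G hG hGr t ht htT x hx (v x) _ <|
      norm_le_toReal_eLpNorm_top isOpen_ball hv hv' (ball_subset_ball (by linarith) hx)⟩

open MollifiedCurvature in
theorem mainTheorem3 (n : ℕ) (p r Q β : ℝ) (hp : 2 * (n : ℝ) < p) (hr : 0 < r) (hQ : 0 < Q)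
    (hβ : 1 / 2 < β) (hβ' : β < 1 - n / p) :
    ∃ T : ℝ, 0 < T ∧ T < r / 2 ∧ ∃ C : ℝ, 0 < C ∧
      ∀ φ : Eucl n → ℝ, IsMollificationKernel φ →
      ∀ (M : Type*) [TopologicalSpace M] [ChartedSpace (Eucl n) M]
        [IsManifold 𝓘(ℝ, Eucl n) ∞ M] (g : SmoothMetric n M) (x₀ : M)
        (ψ : OpenPartialHomeomorph (Eucl n) M), IsPointedChart r x₀ ψ →
      SobolevChartNormLE 2 p r Q (pullbackMetric g ψ) →
      ∀ t : ℝ, 0 < t → t ≤ T →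
        -- the mollified coordinate metric is a smooth Riemannian metric on `B(0, r/2)`
        (∀ a b, ContDiffOn ℝ ∞ (fun x => mollifyMetric φ r t (pullbackMetric g ψ) x a b)
          (ball (0 : Eucl n) (r / 2))) ∧
        (∀ x ∈ ball (0 : Eucl n) (r / 2),
          (mollifyMetric φ r t (pullbackMetric g ψ) x).PosDef) ∧
        -- the curvature estimate, for a bounded smooth section `v`
        ∀ v : Eucl n → Fin 4 → Fin n → ℝ, ContDiffOn ℝ ∞ v (ball (0 : Eucl n) r) →
          MemLp v ∞ (volume.restrict (ball (0 : Eucl n) r)) →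
          ∀ x ∈ ball (0 : Eucl n) (r / 2),
            CurvatureExcessLE (mollifyMetric φ r t (pullbackMetric g ψ)) (pullbackMetric g ψ) x
              (openCube x t) (v x)
              (C * (eLpNorm v ∞ (volume.restrict (ball (0 : Eucl n) r))).toReal ^ 4 * t ^ β) ∧
            (Function.support φ ⊆ closedBall (0 : Eucl n) 1 →
              CurvatureExcessLE (mollifyMetric φ r t (pullbackMetric g ψ)) (pullbackMetric g ψ) x
                (ball x t) (v x)
                (C * (eLpNorm v ∞ (volume.restrict (ball (0 : Eucl n) r))).toReal ^ 4
                  * t ^ β)) := by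
  obtain ⟨T, hT, hTr, C, hC, h⟩ := mainTheorem3_general n p r Q β
    (by linarith [n.cast_nonneg (α := ℝ)]) hr hQ.le hβ'.le
  refine ⟨T, hT, hTr, C, hC, fun φ hφ M _ _ _ g x₀ ψ hψ hG t ht htT => ?_⟩
  have hsmooth := contDiffOn_pullbackMetric g isOpen_ball hψ.contMDiffOn
  obtain ⟨hsmooth', hpos, hexcess⟩ := h φ hφ (pullbackMetric g ψ)
    (fun x _ => isSymm_pullbackMetric g ψ x)
    (fun a b => mod_cast contDiffOn_infty.1 (hsmooth a b) 2) hG t ht htT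
  exact ⟨hsmooth', hpos, fun v hv => hexcess v hv.continuousOn⟩
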